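/- All manifolds, vector bundles and maps are smooth. Let $M$ be a second countable Hausdorff manifold without boundary (finite-dimensional), let $E\to M$ be a real vector bundle of finite rank, and let $\mathfrak g$ be a finite-dimensional real Lie algebra. Write $\Gamma E$ for the space of smooth sections of $E$. A \emph{derivative endomorphism} of $\Gamma E$ is an $\mathbb R$-linear map $D:\Gamma E\to\Gamma E$ for which there is an $\mathbb R$-linear map $D_M:C^\infty(M)\to C^\infty(M)$ with $D(f\psi)=fD\psi+D_M(f)\psi$ for all $f\in C^\infty(M)$, $\psi\in\Gamma E$; these form a Lie algebra under the commutator bracket. Let $\mathfrak D(E)\to M$ be the Lie algebroid of derivative endomorphisms: its fibre at $m$ consists of the pairs $(v,L)$, where $v\in T_mM$ and $L:\Gamma E\to E_m$ is $\mathbb R$-linear with $L(f\psi)=f(m)L(\psi)+v(f)\psi(m)$; a section $m\mapsto(v_m,L_m)$ is smooth if and only if $v$ is a smooth vector field and $m\mapsto L_m(\psi)$ is smooth for every $\psi\in\Gamma E$; its anchor is $(v,L)\mapsto v$, and the bracket of two sections has as its vector field the Lie bracket of their vector fields and as its operator on $\Gamma E$ the commutator of their operators. An \emph{infinitesimal action}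 of $\mathfrak g$ on $M$ is an $\mathbb R$-linear map $X\mapsto X_M$ from $\mathfrak g$ to the smooth vector fields on $M$ with $[X,Y]_M=[X_M,Y_M]$. The corresponding \emph{action Lie algebroid} $\mathfrak g\ltimes M$ is the trivial bundle $M\times\mathfrak g$ with anchor $(m,X)\mapsto X_M(m)$ and with bracket, for smooth $V,W:M\to\mathfrak g$, $$[V,W]=V_M(W)-W_M(V)+[V,W]^\bullet ,$$ where $V_M(m)=(V(m))_M(m)$, $V_M(W)$ is the derivative of $W$ along $V_M$, and $[\cdot,\cdot]^\bullet$ is the pointwise bracket. A \emph{derivative representation} of $\mathfrak g$ on $E$ is a Lie algebra morphism $\rho$ from $\mathfrak g$ to the derivative endomorphisms of $\Gamma E$; it is \emph{associated} to the infinitesimal action $X\mapsto X_M$ if $\rho(X)(f\psi)=f\rho(X)\psi+X_M(f)\psi$ for all $X\in\mathfrak g$, $f\in C^\infty(M)$, $\psi\in\Gamma E$. A \emph{representation} of a Lie algebroid $A\to M$ on $E$ is a Lie algebroid morphism $A\to\mathfrak D(E)$ over the identity of $M$, that is, a smooth vector bundle morphism which intertwines the anchors and preserves the brackets of sections. Theorem.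 Let $X\mapsto X_M$ be an infinitesimal action of $\mathfrak g$ on $M$. There is a one-to-one correspondence $\rho\leftrightarrow\sigma$ between the derivative representations $\rho$ of $\mathfrak g$ on $E$ associated to this infinitesimal action and the representations $\sigma$ of the action Lie algebroid $\mathfrak g\ltimes M$ on $E$. It is given by $\sigma(m,X)=(\rho(X))(m)$, i.e. $\sigma(m,X)\in\mathfrak D(E)_m$ is the pair of $X_M(m)$ and $\psi\mapsto(\rho(X)\psi)(m)$. -/

import Mathlib

open Bundle Module
open scoped Manifold ContDiff Topology

set_option linter.unusedSectionVars false

section Calculus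

variable {EM : Type*} [NormedAddCommGroup EM] [NormedSpace ℝ EM]
  {H : Type*} [TopologicalSpace H] {I : ModelWithCorners ℝ EM H}
  {M : Type*} [TopologicalSpace M] [ChartedSpace H M]
  {W : Type*} [NormedAddCommGroup W] [NormedSpace ℝ W]
  {W' : Type*} [NormedAddCommGroup W'] [NormedSpace ℝ W']

theorem contMDiffAt_mvfderiv_apply [IsManifold I ∞ M] {f : M → W} {X : ∀ x : M, TangentSpace I x}
    {x₀ : M} (hf : ContMDiffAt I 𝓘(ℝ, W) ∞ f x₀)
    (hX : ContMDiffAt I (I.prod 𝓘(ℝ, EM)) ∞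
      (fun x => (⟨x, X x⟩ : TotalSpace EM (TangentSpace I : M → Type _))) x₀) :
    ContMDiffAt I 𝓘(ℝ, W) ∞ (fun x => mvfderiv I f x (X x)) x₀ := by
  have h1 : ContMDiffAt I 𝓘(ℝ, EM →L[ℝ] W) ∞
      (inTangentCoordinates I 𝓘(ℝ, W) id f (mfderiv I 𝓘(ℝ, W) f) x₀) x₀ :=
    hf.mfderiv_const (m := ∞) (by simp)
  have h2 := ContMDiffAt.clm_apply_of_inCoordinates (F₁ := EM) (F₂ := W) (b₁ := id) (b₂ := f)
    (E₁ := (TangentSpace I : M → Type _)) (E₂ := (TangentSpace 𝓘(ℝ, W) : W → Type _))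
    (ϕ := fun m => mfderiv I 𝓘(ℝ, W) f m) (v := X) (IB₁ := I) (IB₂ := 𝓘(ℝ, W))
    h1 hX hf
  exact (contMDiff_snd_tangentBundle_modelSpace W 𝓘(ℝ, W)).contMDiffAt.comp x₀ h2

theorem mvfderiv_clm_comp (ℓ : W →L[ℝ] W') {f : M → W} {x : M}
    (hf : MDifferentiableAt I 𝓘(ℝ, W) f x) (v : TangentSpace I x) :
    mvfderiv I (fun y => ℓ (f y)) x v = ℓ (mvfderiv I f x v) := by
  have := mfderiv_comp_apply (I := I) (I' := 𝓘(ℝ, W)) (I'' := 𝓘(ℝ, W')) (f := f) (g := ℓ) x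
    ℓ.differentiableAt.mdifferentiableAt hf v
  rw [mfderiv_eq_fderiv, ContinuousLinearMap.fderiv] at this
  exact this

theorem mvfderiv_congr {f g : M → W} {x : M} (h : f =ᶠ[𝓝 x] g) (v : TangentSpace I x) :
    mvfderiv I f x v = mvfderiv I g x v := by
  have := h.mfderiv_eq (I := I) (I' := 𝓘(ℝ, W))
  have h2 : (mfderiv I 𝓘(ℝ, W) f x v : W) = mfderiv I 𝓘(ℝ, W) g x v := by
    rw [this]
    rfl
  exact h2

/-- Smoothness of maps into a space of linear maps on a finite-dimensional space is pointwise. -/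
theorem contMDiffAt_clm_of_apply [FiniteDimensional ℝ W] {f : M → W →L[ℝ] W'} {x₀ : M}
    (h : ∀ w, ContMDiffAt I 𝓘(ℝ, W') ∞ (fun x => f x w) x₀) :
    ContMDiffAt I 𝓘(ℝ, W →L[ℝ] W') ∞ f x₀ := by
  let b := Module.finBasis ℝ W
  have e : f = fun x => ∑ i, ContinuousLinearMap.smulRightL ℝ W W'
      (LinearMap.toContinuousLinearMap (b.coord i)) (f x (b i)) := by
    ext x w
    conv_lhs => rw [← b.sum_repr w, map_sum]
    simp
  rw [e]
  refine ContMDiffAt.sum fun i _ => ?_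
  exact (ContinuousLinearMap.contMDiff _).contMDiffAt.comp x₀ (h (b i))

/-- The Leibniz rule for a bilinear map. -/
theorem mvfderiv_bilin {W'' : Type*} [NormedAddCommGroup W''] [NormedSpace ℝ W'']
    (B : W →L[ℝ] W' →L[ℝ] W'') {f : M → W} {g : M → W'} {x : M}
    (hf : MDifferentiableAt I 𝓘(ℝ, W) f x) (hg : MDifferentiableAt I 𝓘(ℝ, W') g x)
    (v : TangentSpace I x) :
    mvfderiv I (fun y => B (f y) (g y)) x v
      = B (mvfderiv I f x v) (g x) + B (f x) (mvfderiv I g x v) := by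
  have h1 := B.hasFDerivWithinAt_of_bilinear hf.hasMFDerivAt.2 hg.hasMFDerivAt.2
  have hc : ContinuousAt (fun y => B (f y) (g y)) x :=
    (B.continuous.continuousAt.comp hf.continuousAt).clm_apply hg.continuousAt
  have hx : (extChartAt I x).symm (extChartAt I x x) = x := extChartAt_to_inv x
  have h3 : HasMFDerivAt I 𝓘(ℝ, W'') (fun y => B (f y) (g y)) x _ := ⟨hc, h1⟩
  replace h3 := h3.mfderiv
  have h4 : (mfderiv I 𝓘(ℝ, W'') (fun y => B (f y) (g y)) x v : W'')
      = B (f x) (mfderiv I 𝓘(ℝ, W') g x v) + B (mfderiv I 𝓘(ℝ, W) f x v) (g x) := by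
    have := congrArg (fun T => (T v : W'')) h3
    simp [writtenInExtChartAt, extChartAt_to_inv] at this
    exact this
  rw [add_comm]
  exact h4

end Calculus

theorem minSmoothness_three_le : minSmoothness ℝ 3 ≤ ∞ := by
  rw [minSmoothness_of_isRCLikeNormedField]
  exact WithTop.coe_le_coe.2 le_top

theorem minSmoothness_two_le : minSmoothness ℝ 2 ≤ ∞ := by
  rw [minSmoothness_of_isRCLikeNormedField]
  exact WithTop.coe_le_coe.2 le_top

section VectorFields

variable {EM : Type*} [NormedAddCommGroup EM] [NormedSpace ℝ EM]
  {H : Type*} [TopologicalSpace H] {I : ModelWithCorners ℝ EM H}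
  {M : Type*} [TopologicalSpace M] [ChartedSpace H M] [IsManifold I ∞ M]
  {W : Type*} [NormedAddCommGroup W] [NormedSpace ℝ W]
  {W' : Type*} [NormedAddCommGroup W'] [NormedSpace ℝ W']

variable (I M) in
/-- `Γ(TM)`, the smooth vector fields on `M`. -/
abbrev SmoothVectorField : Type _ := Cₛ^∞⟮I; EM, (TangentSpace I : M → Type _)⟯

namespace SmoothVectorField

theorem contMDiffAt (X : SmoothVectorField I M) (x : M) :
    ContMDiffAt I (I.prod 𝓘(ℝ, EM)) ∞
      (fun x => (⟨x, X x⟩ : TotalSpace EM (TangentSpace I : M → Type _))) x :=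
  X.contMDiff x

/-- The derivative `X(f)` of a smooth (vector-valued) function `f` along a vector field `X`. -/
noncomputable def deriv (X : SmoothVectorField I M) (f : C^∞⟮I, M; 𝓘(ℝ, W), W⟯) :
    C^∞⟮I, M; 𝓘(ℝ, W), W⟯ :=
  ⟨fun x => mvfderiv I f x (X x), fun x =>
    contMDiffAt_mvfderiv_apply (f.contMDiff x) (X.contMDiffAt x)⟩

theorem deriv_apply (X : SmoothVectorField I M) (f : C^∞⟮I, M; 𝓘(ℝ, W), W⟯) (x : M) :
    X.deriv f x = mvfderiv I f x (X x) := rfl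

theorem mdiffAt (X : SmoothVectorField I M) (x : M) :
    MDifferentiableAt I (I.prod 𝓘(ℝ, EM))
      (fun x => (⟨x, X x⟩ : TotalSpace EM (TangentSpace I : M → Type _))) x :=
  (X.contMDiffAt x).mdifferentiableAt (by simp)

variable [FiniteDimensional ℝ EM]

/-- The Lie bracket of smooth vector fields. -/
noncomputable def bracket (X Y : SmoothVectorField I M) : SmoothVectorField I M :=
  ⟨fun x => VectorField.mlieBracket I X Y x, fun x => by
    have := FiniteDimensional.complete ℝ EM
    have : IsManifold I (minSmoothness ℝ 2) M := IsManifold.of_le (minSmoothness_two_le)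
    have : IsManifold I ((((⊤ : ℕ∞) : ℕ∞) : WithTop ℕ∞) + 1) M := ‹IsManifold I ∞ M›
    exact ContMDiffAt.mlieBracket_vectorField (m := ⊤) (n := ⊤)
      (X.contMDiffAt x) (Y.contMDiffAt x) (by simp)⟩

theorem bracket_apply (X Y : SmoothVectorField I M) (x : M) :
    X.bracket Y x = VectorField.mlieBracket I X Y x := rfl

theorem jacobi (X Y Z : SmoothVectorField I M) :
    X.bracket (Y.bracket Z) = (X.bracket Y).bracket Z + Y.bracket (X.bracket Z) := by
  have := FiniteDimensional.complete ℝ EM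
  have : IsManifold I (minSmoothness ℝ 3) M := IsManifold.of_le (minSmoothness_three_le)
  have h := minSmoothness_two_le
  ext x
  exact VectorField.leibniz_identity_mlieBracket_apply ((X.contMDiffAt x).of_le h)
    ((Y.contMDiffAt x).of_le h) ((Z.contMDiffAt x).of_le h)

theorem module_aux {V : Type*} [AddCommGroup V] [Module ℝ V] {w p q r s : V} {a b c f d e : ℝ}
    (h : a • w + b • p + c • q + f • (r + s) = d • w + f • r + (e • w + c • q + b • p + f • s)) :
    (d - (a - e)) • w = 0 := by
  rw [← neg_eq_zero, ← sub_eq_zero.2 h]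
  module

theorem deriv_bracket_real (X Y : SmoothVectorField I M) (f : C^∞⟮I, M; 𝓘(ℝ, ℝ), ℝ⟯) :
    (X.bracket Y).deriv f = X.deriv (Y.deriv f) - Y.deriv (X.deriv f) := by
  have := FiniteDimensional.complete ℝ EM
  have i3 : IsManifold I (minSmoothness ℝ 3) M := IsManifold.of_le (minSmoothness_three_le)
  have i2 : IsManifold I (minSmoothness ℝ 2) M := IsManifold.of_le (minSmoothness_two_le)
  have h2 := minSmoothness_two_le
  ext x
  rcases subsingleton_or_nontrivial EM with hs | hs
  · have h0 (v : TangentSpace I x) : v = 0 := hs.elim (α := EM) v 0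
    simp [deriv_apply, h0]
  obtain ⟨w, hw⟩ := exists_ne (0 : EM)
  let Z := FiberBundle.extend EM (E := (TangentSpace I : M → Type _)) (x := x) w
  have hZx : Z x = w := FiberBundle.extend_apply_self EM _
  obtain ⟨s, hs, hZ⟩ := FiberBundle.exists_contMDiffOn_extend (k := ∞) I EM
    (V := (TangentSpace I : M → Type _)) (x₀ := x) w
  have hZ' : ∀ᶠ y in 𝓝 x, ContMDiffAt I (I.prod 𝓘(ℝ, EM)) ∞
      (fun x => (⟨x, Z x⟩ : TotalSpace EM (TangentSpace I : M → Type _))) y := by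
    filter_upwards [eventually_mem_nhds_iff.2 hs] with y hy
    exact (hZ y (mem_of_mem_nhds hy)).contMDiffAt hy
  have key (A B : SmoothVectorField I M) :
      VectorField.mlieBracket I A (VectorField.mlieBracket I B (⇑f • Z)) x
      = A.deriv (B.deriv f) x • Z x + B.deriv f x • VectorField.mlieBracket I A Z x
        + A.deriv f x • VectorField.mlieBracket I B Z x
        + f x • VectorField.mlieBracket I A (VectorField.mlieBracket I B Z) x := by
    have e : VectorField.mlieBracket I B (⇑f • Z) =ᶠ[𝓝 x]
        ((⇑(B.deriv f) • Z) + ⇑f • VectorField.mlieBracket I B Z : ∀ x, TangentSpace I x) := by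
      filter_upwards [hZ'] with y hy
      rw [VectorField.mlieBracket_smul_right (f.contMDiff y |>.mdifferentiableAt (by simp))
        (hy.mdifferentiableAt (by simp))]
      rfl
    have hZd := hZ'.self_of_nhds
    have hBZ : ContMDiffAt I (I.prod 𝓘(ℝ, EM)) ∞ (fun y => (⟨y, VectorField.mlieBracket I B Z y⟩
        : TotalSpace EM (TangentSpace I : M → Type _))) x := by
      have : IsManifold I ((((⊤ : ℕ∞) : ℕ∞) : WithTop ℕ∞) + 1) M := ‹IsManifold I ∞ M›
      exact ContMDiffAt.mlieBracket_vectorField (m := ⊤) (n := ⊤)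
        (B.contMDiffAt x) hZd (by simp)
    refine (Filter.EventuallyEq.mlieBracket_vectorField_eq Filter.EventuallyEq.rfl e).trans ?_
    rw [VectorField.mlieBracket_add_right, VectorField.mlieBracket_smul_right,
      VectorField.mlieBracket_smul_right]
    · rw [← add_assoc]
      rfl
    · exact (f.contMDiff x).mdifferentiableAt (by simp)
    · exact hBZ.mdifferentiableAt (by simp)
    · exact ((B.deriv f).contMDiff x).mdifferentiableAt (by simp)
    · exact hZd.mdifferentiableAt (by simp)
    · exact (((B.deriv f).contMDiff x).smul_section hZd).mdifferentiableAt (by simp)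
    · exact ((f.contMDiff x).smul_section hBZ).mdifferentiableAt (by simp)
  have hZd := hZ'.self_of_nhds
  have J1 := VectorField.leibniz_identity_mlieBracket_apply ((X.contMDiffAt x).of_le h2)
    ((Y.contMDiffAt x).of_le h2) ((((f.contMDiff x).smul_section hZd)).of_le h2)
  have J2 := VectorField.leibniz_identity_mlieBracket_apply ((X.contMDiffAt x).of_le h2)
    ((Y.contMDiffAt x).of_le h2) (hZd.of_le h2)
  rw [key X Y, key Y X, VectorField.mlieBracket_smul_right
    ((f.contMDiff x).mdifferentiableAt (by simp)) (hZd.mdifferentiableAt (by simp)), J2] at J1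
  have J3 : (mvfderiv I f x (VectorField.mlieBracket I X Y x)
      - (X.deriv (Y.deriv f) x - Y.deriv (X.deriv f) x)) • w = 0 := by
    rw [hZx] at J1
    exact module_aux (V := EM) J1
  have := (smul_eq_zero.1 J3).resolve_right hw
  exact sub_eq_zero.1 this

theorem deriv_bracket (X Y : SmoothVectorField I M) (f : C^∞⟮I, M; 𝓘(ℝ, W), W⟯) :
    (X.bracket Y).deriv f = X.deriv (Y.deriv f) - Y.deriv (X.deriv f) := by
  ext x
  refine (SeparatingDual.eq_iff_forall_dual_eq (R := ℝ)).2 fun ℓ => ?_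
  have hl (g : C^∞⟮I, M; 𝓘(ℝ, W), W⟯) (Z : SmoothVectorField I M) (y : M) :
      ℓ (Z.deriv g y) = mvfderiv I (fun z => ℓ (g z)) y (Z y) :=
    (mvfderiv_clm_comp ℓ ((g.contMDiff y).mdifferentiableAt (by simp)) (Z y)).symm
  let f' : C^∞⟮I, M; 𝓘(ℝ, ℝ), ℝ⟯ := ⟨fun z => ℓ (f z), ℓ.contMDiff.comp f.contMDiff⟩
  have h := congrArg (fun g => g x) (deriv_bracket_real X Y f')
  rw [hl]
  refine h.trans ?_
  rw [ContMDiffMap.coe_sub, ContMDiffMap.coe_sub, Pi.sub_apply, Pi.sub_apply, map_sub, hl, hl]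
  have h2 (Z : SmoothVectorField I M) : (fun z => ℓ (Z.deriv f z)) = ⇑(Z.deriv f') := by
    ext z
    exact hl f Z z
  rw [h2, h2]
  rfl

end SmoothVectorField

end VectorFields

attribute [local instance 100] LieRing.ofAssociativeRing

section Operators

variable {EM : Type*} [NormedAddCommGroup EM] [NormedSpace ℝ EM]
  {H : Type*} [TopologicalSpace H] {I : ModelWithCorners ℝ EM H}
  {M : Type*} [TopologicalSpace M] [ChartedSpace H M]
  {F : Type*} [NormedAddCommGroup F] [NormedSpace ℝ F]
  {E : M → Type*} [TopologicalSpace (TotalSpace F E)] [∀ x, AddCommGroup (E x)]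
  [∀ x, Module ℝ (E x)] [∀ x, TopologicalSpace (E x)] [FiberBundle F E] [VectorBundle ℝ F E]

/-- Multiplication of a smooth section by a smooth function. -/
noncomputable instance ContMDiffSection.instSMulContMDiffMap :
    SMul C^∞⟮I, M; 𝓘(ℝ, ℝ), ℝ⟯ Cₛ^∞⟮I; F, E⟯ :=
  ⟨fun f ψ => ⟨⇑f • ⇑ψ, f.contMDiff.smul_section ψ.contMDiff⟩⟩

/-- Evaluation of sections at a point, as a linear map. -/
noncomputable def ContMDiffSection.evalAt (x : M) : Cₛ^∞⟮I; F, E⟯ →ₗ[ℝ] E x where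
  toFun ψ := ψ x
  map_add' _ _ := rfl
  map_smul' _ _ := rfl

theorem ContMDiffSection.fsmul_apply (f : C^∞⟮I, M; 𝓘(ℝ, ℝ), ℝ⟯) (ψ : Cₛ^∞⟮I; F, E⟯) (x : M) :
    (f • ψ) x = f x • ψ x := rfl

variable (I F E) in
/-- The derivative endomorphisms of `ΓE`: the `ℝ`-linear endomorphisms `D` of `ΓE` for which there
is an `ℝ`-linear endomorphism `D_M` of `C^∞(M)` with `D(fψ) = f D(ψ) + D_M(f) ψ`. They form a Lie
algebra under the commutator bracket. -/
noncomputable def derivativeEndomorphisms : LieSubalgebra ℝ (Module.End ℝ Cₛ^∞⟮I; F, E⟯) where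
  carrier := {D | ∃ DM : C^∞⟮I, M; 𝓘(ℝ, ℝ), ℝ⟯ →ₗ[ℝ] C^∞⟮I, M; 𝓘(ℝ, ℝ), ℝ⟯,
    ∀ (f : C^∞⟮I, M; 𝓘(ℝ, ℝ), ℝ⟯) (ψ : Cₛ^∞⟮I; F, E⟯), D (f • ψ) = f • D ψ + DM f • ψ}
  add_mem' := by
    rintro D D' ⟨DM, h⟩ ⟨DM', h'⟩
    refine ⟨DM + DM', fun f ψ => ?_⟩
    ext x
    simp only [LinearMap.add_apply, h, h', ContMDiffSection.coe_add, Pi.add_apply,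
      ContMDiffSection.fsmul_apply, ContMDiffMap.coe_add, smul_add, add_smul]
    abel
  zero_mem' := ⟨0, fun f ψ => by
    ext x
    simp only [LinearMap.zero_apply, ContMDiffSection.coe_add, Pi.add_apply,
      ContMDiffSection.fsmul_apply, ContMDiffMap.coe_zero, Pi.zero_apply, zero_smul,
      ContMDiffSection.coe_zero, smul_zero, add_zero]⟩
  smul_mem' := by
    rintro c D ⟨DM, h⟩
    refine ⟨c • DM, fun f ψ => ?_⟩
    ext x
    simp only [LinearMap.smul_apply, h, ContMDiffSection.coe_add, Pi.add_apply,
      ContMDiffSection.fsmul_apply, ContMDiffMap.coe_smul, ContMDiffSection.coe_smul,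
      Pi.smul_apply, smul_add, smul_assoc]
    rw [smul_comm]
  lie_mem' := by
    rintro D D' ⟨DM, h⟩ ⟨DM', h'⟩
    refine ⟨DM ∘ₗ DM' - DM' ∘ₗ DM, fun f ψ => ?_⟩
    ext x
    simp only [LieRing.of_associative_ring_bracket, LinearMap.sub_apply, Module.End.mul_apply, h,
      h', map_add, ContMDiffSection.coe_add, Pi.add_apply, ContMDiffSection.coe_sub, Pi.sub_apply,
      ContMDiffSection.fsmul_apply, ContMDiffMap.coe_sub, LinearMap.comp_apply, smul_sub, sub_smul]
    abel

variable (I F E) in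
/-- The fibre at `x` of the bundle `𝔇(E)` of derivative endomorphisms: pairs `(v, L)` of a tangent
vector `v` at `x` and an `ℝ`-linear map `L : ΓE → E_x` with `L(fψ) = f(x) L(ψ) + v(f) ψ(x)`.
(If `E` has positive rank, `v` is determined by `L`.) -/
noncomputable def DerFiber (x : M) : Submodule ℝ (TangentSpace I x × (Cₛ^∞⟮I; F, E⟯ →ₗ[ℝ] E x)) where
  carrier := {d | ∀ (f : C^∞⟮I, M; 𝓘(ℝ, ℝ), ℝ⟯) (ψ : Cₛ^∞⟮I; F, E⟯),
    d.2 (f • ψ) = f x • d.2 ψ + mvfderiv I f x d.1 • ψ x}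
  add_mem' := by
    intro a b ha hb f ψ
    simp only [Prod.snd_add, Prod.fst_add, LinearMap.add_apply, ha f ψ, hb f ψ, map_add, add_smul,
      smul_add]
    abel
  zero_mem' := fun f ψ => by simp
  smul_mem' := by
    intro c a ha f ψ
    simp only [Prod.smul_snd, Prod.smul_fst, LinearMap.smul_apply, ha f ψ, map_smul, smul_add,
      smul_assoc]
    rw [smul_comm]

variable (I F E) in
/-- The bundle `𝔇(E)` over `M`, as a family of vector spaces. -/
noncomputable def DerBundle (x : M) : Type _ := DerFiber I F E x

noncomputable instance (x : M) : AddCommGroup (DerBundle I F E x) :=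
  inferInstanceAs (AddCommGroup (DerFiber I F E x))

noncomputable instance (x : M) : Module ℝ (DerBundle I F E x) :=
  inferInstanceAs (Module ℝ (DerFiber I F E x))

namespace DerBundle

/-- The tangent vector underlying an element of `𝔇(E)_x`, i.e. its image under the anchor. -/
noncomputable def vec {x : M} : DerBundle I F E x →ₗ[ℝ] TangentSpace I x :=
  LinearMap.fst ℝ _ _ ∘ₗ (DerFiber I F E x).subtype

/-- The operator `ΓE → E_x` underlying an element of `𝔇(E)_x`. -/
noncomputable def op {x : M} : DerBundle I F E x →ₗ[ℝ] (Cₛ^∞⟮I; F, E⟯ →ₗ[ℝ] E x) :=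
  LinearMap.snd ℝ _ _ ∘ₗ (DerFiber I F E x).subtype

theorem op_fsmul {x : M} (d : DerBundle I F E x) (f : C^∞⟮I, M; 𝓘(ℝ, ℝ), ℝ⟯)
    (ψ : Cₛ^∞⟮I; F, E⟯) : d.op (f • ψ) = f x • d.op ψ + mvfderiv I f x d.vec • ψ x :=
  d.2 f ψ

theorem ext {x : M} {d d' : DerBundle I F E x} (h : d.vec = d'.vec) (h' : d.op = d'.op) : d = d' :=
  Subtype.ext (Prod.ext h h')

/-- The element of `𝔇(E)_x` with given tangent vector and operator. -/
noncomputable def mk {x : M} (v : TangentSpace I x) (L : Cₛ^∞⟮I; F, E⟯ →ₗ[ℝ] E x)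
    (h : ∀ (f : C^∞⟮I, M; 𝓘(ℝ, ℝ), ℝ⟯) (ψ : Cₛ^∞⟮I; F, E⟯),
      L (f • ψ) = f x • L ψ + mvfderiv I f x v • ψ x) : DerBundle I F E x := ⟨(v, L), h⟩

theorem vec_mk {x : M} (v : TangentSpace I x) (L : Cₛ^∞⟮I; F, E⟯ →ₗ[ℝ] E x)
    (h : ∀ (f : C^∞⟮I, M; 𝓘(ℝ, ℝ), ℝ⟯) (ψ : Cₛ^∞⟮I; F, E⟯),
      L (f • ψ) = f x • L ψ + mvfderiv I f x v • ψ x) : (mk v L h).vec = v := rfl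

theorem op_mk {x : M} (v : TangentSpace I x) (L : Cₛ^∞⟮I; F, E⟯ →ₗ[ℝ] E x)
    (h : ∀ (f : C^∞⟮I, M; 𝓘(ℝ, ℝ), ℝ⟯) (ψ : Cₛ^∞⟮I; F, E⟯),
      L (f • ψ) = f x • L ψ + mvfderiv I f x v • ψ x) : (mk v L h).op = L := rfl

end DerBundle

/-! ### Local descriptions -/

variable (F) in
/-- The local representative of a section in the preferred trivialization at `p`. -/
noncomputable def localRep (p : M) (ψ : ∀ x, E x) (y : M) : F :=
  (trivializationAt F E p).continuousLinearMapAt ℝ y (ψ y)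

theorem localRep_eventuallyEq {p x : M} (hx : x ∈ (trivializationAt F E p).baseSet)
    (ψ : ∀ x, E x) :
    localRep F p ψ =ᶠ[𝓝 x] fun y => (trivializationAt F E p ⟨y, ψ y⟩).2 := by
  filter_upwards [(trivializationAt F E p).open_baseSet.mem_nhds hx] with y hy
  simp [localRep, Trivialization.coe_linearMapAt_of_mem _ hy]


theorem contMDiffAt_localRep_iff [ContMDiffVectorBundle ∞ F E I] {p x : M} (hx : x ∈ (trivializationAt F E p).baseSet)
    {ψ : ∀ x, E x} :
    ContMDiffAt I (I.prod 𝓘(ℝ, F)) ∞ (fun y => (⟨y, ψ y⟩ : TotalSpace F E)) x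
      ↔ ContMDiffAt I 𝓘(ℝ, F) ∞ (localRep F p ψ) x := by
  rw [(localRep_eventuallyEq hx ψ).contMDiffAt_iff]
  exact (trivializationAt F E p).contMDiffAt_section_iff hx

theorem contMDiffAt_localRep [ContMDiffVectorBundle ∞ F E I] {p x : M} (hx : x ∈ (trivializationAt F E p).baseSet)
    (ψ : Cₛ^∞⟮I; F, E⟯) : ContMDiffAt I 𝓘(ℝ, F) ∞ (localRep F p ψ) x :=
  (contMDiffAt_localRep_iff hx).1 (ψ.contMDiff x)

theorem localRep_add (p : M) (ψ φ : Cₛ^∞⟮I; F, E⟯) :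
    localRep F p ⇑(ψ + φ) = localRep F p ψ + localRep F p φ := by
  ext y
  simp [localRep]

theorem localRep_smul (p : M) (c : ℝ) (ψ : Cₛ^∞⟮I; F, E⟯) :
    localRep F p ⇑(c • ψ) = c • localRep F p ψ := by
  ext y
  simp [localRep]

theorem localRep_fsmul (p : M) (f : C^∞⟮I, M; 𝓘(ℝ, ℝ), ℝ⟯) (ψ : Cₛ^∞⟮I; F, E⟯) :
    localRep F p ⇑(f • ψ) = ⇑f • localRep F p ψ := by
  ext y
  simp [localRep, ContMDiffSection.fsmul_apply]

theorem exists_localFrame [ContMDiffVectorBundle ∞ F E I] [FiniteDimensional ℝ EM] [T2Space M] [IsManifold I ∞ M] {p x : M}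
    (hx : x ∈ (trivializationAt F E p).baseSet) :
    ∃ (χ : C^∞⟮I, M; 𝓘(ℝ, ℝ), ℝ⟯) (S : F →ₗ[ℝ] Cₛ^∞⟮I; F, E⟯), ⇑χ =ᶠ[𝓝 x] 1 ∧
      tsupport χ ⊆ (trivializationAt F E p).baseSet ∧
      ∀ w y, S w y = χ y • (trivializationAt F E p).symmL ℝ y w := by
  set e := trivializationAt F E p
  obtain ⟨b, -, hb⟩ := (SmoothBumpFunction.nhds_basis_tsupport (I := I) x).mem_iff.1
    (e.open_baseSet.mem_nhds hx)
  have hs (w : F) : ContMDiff I (I.prod 𝓘(ℝ, F)) ∞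
      (fun y => (⟨y, (⇑b • fun y => e.symmL ℝ y w : ∀ y, E y) y⟩ : TotalSpace F E)) := by
    refine ContMDiffOn.smul_section_of_tsupport (u := e.baseSet) b.contMDiff.contMDiffOn
      e.open_baseSet hb ?_
    intro y hy
    refine ContMDiffAt.contMDiffWithinAt ((contMDiffAt_localRep_iff (p := p) hy).2 ?_)
    refine (contMDiffAt_const (c := w)).congr_of_eventuallyEq ?_
    filter_upwards [e.open_baseSet.mem_nhds hy] with z hz
    exact e.continuousLinearMapAt_symmL hz w
  refine ⟨⟨b, b.contMDiff⟩, ⟨⟨fun w => ⟨_, hs w⟩, ?_⟩, ?_⟩, b.eventuallyEq_one, hb,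
    fun w y => rfl⟩
  · intro w w'
    ext y
    change b y • e.symmL ℝ y (w + w') = b y • e.symmL ℝ y w + b y • e.symmL ℝ y w'
    rw [map_add, smul_add]
  · intro c w
    ext y
    change b y • e.symmL ℝ y (c • w) = c • b y • e.symmL ℝ y w
    rw [map_smul, smul_comm]

theorem localRep_localFrame {p x : M} (hx : x ∈ (trivializationAt F E p).baseSet)
    {χ : C^∞⟮I, M; 𝓘(ℝ, ℝ), ℝ⟯} {S : F →ₗ[ℝ] Cₛ^∞⟮I; F, E⟯} (hχ : ⇑χ =ᶠ[𝓝 x] 1)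
    (hS : ∀ w y, S w y = χ y • (trivializationAt F E p).symmL ℝ y w) (w : F) :
    localRep F p (S w) =ᶠ[𝓝 x] fun _ => w := by
  filter_upwards [(trivializationAt F E p).open_baseSet.mem_nhds hx, hχ] with z hz hz'
  rw [localRep, hS, hz', map_smul, Trivialization.continuousLinearMapAt_symmL _ hz]
  simp

end Operators

section DerBundleTopology

variable {EM : Type*} [NormedAddCommGroup EM] [NormedSpace ℝ EM] [FiniteDimensional ℝ EM]
  {H : Type*} [TopologicalSpace H] {I : ModelWithCorners ℝ EM H}
  {M : Type*} [TopologicalSpace M] [ChartedSpace H M] [IsManifold I ∞ M] [T2Space M]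
  {F : Type*} [NormedAddCommGroup F] [NormedSpace ℝ F] [FiniteDimensional ℝ F]
  {E : M → Type*} [TopologicalSpace (TotalSpace F E)] [∀ x, AddCommGroup (E x)]
  [∀ x, Module ℝ (E x)] [∀ x, TopologicalSpace (E x)] [FiberBundle F E] [VectorBundle ℝ F E]
  [ContMDiffVectorBundle ∞ F E I]

namespace DerBundle

variable (I F E) in
/-- The open set over which `𝔇(E)` is trivialized around `p`. -/
def triv_set (p : M) : Set M :=
  (trivializationAt F E p).baseSet ∩
    (trivializationAt EM (TangentSpace I : M → Type _) p).baseSet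

theorem mdiffAt_localRep {p x : M} (hx : x ∈ triv_set I F E p) (ψ : Cₛ^∞⟮I; F, E⟯) :
    MDifferentiableAt I 𝓘(ℝ, F) (localRep F p ψ) x :=
  (contMDiffAt_localRep hx.1 ψ).mdifferentiableAt (by simp)

/-- In the trivializations around `p`, an element of `𝔇(E)_x` is a vector `u` together with an
endomorphism `B`, acting on sections by `ψ ↦ dψ(u) + B ψ(x)`. -/
noncomputable def ofModel (p x : M) (hx : x ∈ triv_set I F E p) :
    (EM × (F →L[ℝ] F)) →ₗ[ℝ] DerBundle I F E x where
  toFun u := mk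
    ((trivializationAt EM (TangentSpace I : M → Type _) p).symmL ℝ x u.1)
    { toFun := fun ψ => (trivializationAt F E p).symmL ℝ x
        (mvfderiv I (localRep F p ψ) x
          ((trivializationAt EM (TangentSpace I : M → Type _) p).symmL ℝ x u.1)
          + u.2 (localRep F p ψ x))
      map_add' := fun ψ φ => by
        rw [localRep_add, mvfderiv_add (mdiffAt_localRep hx ψ) (mdiffAt_localRep hx φ), ← map_add]
        simp only [add_apply, Pi.add_apply, map_add]
        abel
      map_smul' := fun c ψ => by
        have : localRep F p ⇑(c • ψ) = (fun _ : M => c) • localRep F p ψ := localRep_smul p c ψ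
        rw [this, mvfderiv_smul mdifferentiableAt_const (mdiffAt_localRep hx ψ), mvfderiv_const]
        simp [smul_add] }
    (fun f ψ => by
      simp only [LinearMap.coe_mk, AddHom.coe_mk]
      rw [localRep_fsmul, mvfderiv_smul ((f.contMDiff x).mdifferentiableAt (by simp))
        (mdiffAt_localRep hx ψ)]
      have : ψ x = (trivializationAt F E p).symmL ℝ x (localRep F p ψ x) :=
        ((trivializationAt F E p).symmL_continuousLinearMapAt hx.1 _).symm
      rw [this]
      simp only [add_apply, smul_apply,
        ContinuousLinearMap.smulRight_apply, Pi.smul_apply', map_add, map_smul, smul_add]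
      abel)
  map_add' u u' := by
    refine DerBundle.ext (by simp [vec_mk]) ?_
    ext ψ
    simp [op_mk]
    abel
  map_smul' c u := by
    refine DerBundle.ext (by simp [vec_mk]) ?_
    ext ψ
    simp [op_mk]

theorem ofModel_bijective (p x : M) (hx : x ∈ triv_set I F E p) :
    Function.Bijective (ofModel p x hx) := by
  set e := trivializationAt F E p
  set t := trivializationAt EM (TangentSpace I : M → Type _) p
  obtain ⟨χ, S, hχ, hsupp, hS⟩ := exists_localFrame (I := I) (F := F) (E := E) hx.1
  have hrep := localRep_localFrame hx.1 hχ hS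
  have hd (w : F) : mvfderiv I (localRep F p (S w)) x = 0 := by
    ext v
    rw [mvfderiv_congr (hrep w) v, mvfderiv_const]
  constructor
  · rw [injective_iff_map_eq_zero]
    rintro ⟨u, B⟩ h
    have h1 : t.symmL ℝ x u = 0 := congrArg (fun d => DerBundle.vec d) h
    have h2 (w : F) : e.symmL ℝ x (mvfderiv I (localRep F p (S w)) x (t.symmL ℝ x u)
          + B (localRep F p (S w) x)) = 0 := congrArg (fun d => DerBundle.op d (S w)) h
    have hu : u = 0 := by
      rw [← t.continuousLinearMapAt_symmL (R := ℝ) hx.2 u, h1, map_zero]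
    have hB : B = 0 := by
      ext w
      have := h2 w
      rw [hd, (hrep w).self_of_nhds] at this
      have h3 := congrArg (e.continuousLinearMapAt ℝ x) this
      rw [e.continuousLinearMapAt_symmL hx.1] at h3
      simpa using h3
    rw [hu, hB]
    rfl
  · intro d
    -- the zeroth order part, as an operator on sections
    have hL (ψ φ : Cₛ^∞⟮I; F, E⟯) : mvfderiv I (localRep F p ⇑(ψ + φ)) x
        = mvfderiv I (localRep F p ψ) x + mvfderiv I (localRep F p φ) x := by
      rw [localRep_add, mvfderiv_add (mdiffAt_localRep hx ψ) (mdiffAt_localRep hx φ)]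
    let L : Cₛ^∞⟮I; F, E⟯ →ₗ[ℝ] F :=
      { toFun := fun ψ => e.continuousLinearMapAt ℝ x (d.op ψ)
          - mvfderiv I (localRep F p ψ) x d.vec
        map_add' := fun ψ φ => by
          rw [hL]
          simp only [map_add, add_apply]
          abel
        map_smul' := fun c ψ => by
          have : localRep F p ⇑(c • ψ) = (fun _ : M => c) • localRep F p ψ := localRep_smul p c ψ
          rw [this, mvfderiv_smul mdifferentiableAt_const (mdiffAt_localRep hx ψ), mvfderiv_const]
          simp [smul_sub] }
    have Lf (f : C^∞⟮I, M; 𝓘(ℝ, ℝ), ℝ⟯) (ψ : Cₛ^∞⟮I; F, E⟯) : L (f • ψ) = f x • L ψ := by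
      change e.continuousLinearMapAt ℝ x (d.op (f • ψ)) - mvfderiv I (localRep F p ⇑(f • ψ)) x d.vec
        = f x • (e.continuousLinearMapAt ℝ x (d.op ψ) - mvfderiv I (localRep F p ψ) x d.vec)
      rw [op_fsmul, localRep_fsmul, mvfderiv_smul ((f.contMDiff x).mdifferentiableAt (by simp))
        (mdiffAt_localRep hx ψ)]
      simp only [map_add, map_smul, add_apply, smul_apply,
        ContinuousLinearMap.smulRight_apply, smul_sub]
      change _ + _ • localRep F p ψ x - _ = _
      abel
    have Ltens (ψ : Cₛ^∞⟮I; F, E⟯) : L ψ = L (S (localRep F p ψ x)) := by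
      let b := Module.finBasis ℝ F
      have hg (i) : ContMDiff I 𝓘(ℝ, ℝ) ∞
          (fun y => χ y • b.coord i (localRep F p ψ y)) := by
        refine contMDiff_of_tsupport fun y hy => ?_
        have hy' : y ∈ e.baseSet := hsupp (closure_mono (Function.support_smul_subset_left _ _) hy)
        exact (χ.contMDiff y).smul ((LinearMap.toContinuousLinearMap
          (b.coord i)).contMDiff.contMDiffAt.comp y (contMDiffAt_localRep hy' ψ))
      let g (i) : C^∞⟮I, M; 𝓘(ℝ, ℝ), ℝ⟯ := ⟨_, hg i⟩
      have h1 : χ • χ • ψ = ∑ i, g i • S (b i) := by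
        ext y
        have hsum : (∑ i, g i • S (b i)) y = ∑ i, g i y • S (b i) y :=
          map_sum (ContMDiffSection.evalAt (I := I) (F := F) (E := E) y)
            (fun i => g i • S (b i)) Finset.univ
        rw [hsum]
        simp only [ContMDiffSection.fsmul_apply, hS]
        by_cases hy : y ∈ e.baseSet
        · have hψ : ψ y = e.symmL ℝ y (localRep F p ψ y) :=
            (e.symmL_continuousLinearMapAt hy _).symm
          rw [hψ]
          conv_lhs => rw [← b.sum_repr (localRep F p ψ y)]
          simp only [map_sum, map_smul, Finset.smul_sum]
          refine Finset.sum_congr rfl fun i _ => ?_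
          change _ = (χ y • b.coord i (localRep F p ψ y)) • _
          rw [Basis.coord_apply, smul_assoc, smul_comm (χ y) (b.repr _ i) (_ : E y)]
        · have : χ y = 0 := image_eq_zero_of_notMem_tsupport fun h => hy (hsupp h)
          simp [this]
      have hχx : χ x = 1 := hχ.self_of_nhds
      have h2 : L ψ = L (χ • χ • ψ) := by rw [Lf, Lf, hχx, one_smul, one_smul]
      rw [h2, h1, map_sum]
      conv_rhs => rw [← b.sum_repr (localRep F p ψ x)]
      simp only [map_sum, map_smul, Lf]
      refine Finset.sum_congr rfl fun i _ => ?_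
      change (χ x • b.coord i (localRep F p ψ x)) • _ = _
      rw [hχx, one_smul, Basis.coord_apply]
    refine ⟨(t.continuousLinearMapAt ℝ x d.vec, LinearMap.toContinuousLinearMap (L ∘ₗ S)), ?_⟩
    have hv : t.symmL ℝ x (t.continuousLinearMapAt ℝ x d.vec) = d.vec :=
      t.symmL_continuousLinearMapAt hx.2 _
    refine DerBundle.ext hv ?_
    ext ψ
    change e.symmL ℝ x (mvfderiv I (localRep F p ψ) x
      (t.symmL ℝ x (t.continuousLinearMapAt ℝ x d.vec)) + L (S (localRep F p ψ x))) = _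
    rw [hv, ← Ltens]
    change e.symmL ℝ x (_ + (e.continuousLinearMapAt ℝ x (d.op ψ) - _)) = _
    rw [add_sub_cancel, e.symmL_continuousLinearMapAt hx.1]

/-- The fibrewise coordinates on `𝔇(E)` around `p`. -/
noncomputable def toModel (p x : M) (hx : x ∈ triv_set I F E p) :
    DerBundle I F E x ≃ₗ[ℝ] EM × (F →L[ℝ] F) :=
  (LinearEquiv.ofBijective _ (ofModel_bijective p x hx)).symm

theorem ofModel_toModel {p x : M} (hx : x ∈ triv_set I F E p) (d : DerBundle I F E x) :
    ofModel p x hx (toModel p x hx d) = d :=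
  (LinearEquiv.ofBijective _ (ofModel_bijective p x hx)).apply_symm_apply d

theorem vec_eq {p x : M} (hx : x ∈ triv_set I F E p) (d : DerBundle I F E x) :
    d.vec = (trivializationAt EM (TangentSpace I : M → Type _) p).symmL ℝ x
      (toModel p x hx d).1 :=
  congrArg (fun d => DerBundle.vec d) (ofModel_toModel hx d).symm

theorem op_eq {p x : M} (hx : x ∈ triv_set I F E p) (d : DerBundle I F E x)
    (ψ : Cₛ^∞⟮I; F, E⟯) :
    (trivializationAt F E p).continuousLinearMapAt ℝ x (d.op ψ) =
      mvfderiv I (localRep F p ψ) x d.vec + (toModel p x hx d).2 (localRep F p ψ x) := by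
  have h := congrArg (fun d => DerBundle.op d ψ) (ofModel_toModel hx d)
  have h' : (trivializationAt F E p).symmL ℝ x (mvfderiv I (localRep F p ψ) x
      ((trivializationAt EM (TangentSpace I : M → Type _) p).symmL ℝ x (toModel p x hx d).1)
        + (toModel p x hx d).2 (localRep F p ψ x)) = d.op ψ := h
  rw [← h', Trivialization.continuousLinearMapAt_symmL _ hx.1, ← vec_eq hx d]

end DerBundle

end DerBundleTopology

section DerBundleStructure

variable {EM : Type*} [NormedAddCommGroup EM] [NormedSpace ℝ EM] [FiniteDimensional ℝ EM]
  {H : Type*} [TopologicalSpace H] {I : ModelWithCorners ℝ EM H}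
  {M : Type*} [TopologicalSpace M] [ChartedSpace H M] [IsManifold I ∞ M] [T2Space M]
  {F : Type*} [NormedAddCommGroup F] [NormedSpace ℝ F] [FiniteDimensional ℝ F]
  {E : M → Type*} [TopologicalSpace (TotalSpace F E)] [∀ x, AddCommGroup (E x)]
  [∀ x, Module ℝ (E x)] [∀ x, TopologicalSpace (E x)] [FiberBundle F E] [VectorBundle ℝ F E]
  [ContMDiffVectorBundle ∞ F E I]

namespace DerBundle

open Classical in
/-- `toModel`, extended by `0` outside of the set where it is defined. -/
noncomputable def coordMap (p x : M) : DerBundle I F E x →ₗ[ℝ] EM × (F →L[ℝ] F) :=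
  if hx : x ∈ triv_set I F E p then (toModel p x hx).toLinearMap else 0

theorem coordMap_of_mem {p x : M} (hx : x ∈ triv_set I F E p) (d : DerBundle I F E x) :
    coordMap p x d = toModel p x hx d := by
  simp [coordMap, hx]

theorem isOpen_triv_set (p : M) : IsOpen (triv_set I F E p) :=
  (trivializationAt F E p).open_baseSet.inter
    (trivializationAt EM (TangentSpace I : M → Type _) p).open_baseSet

theorem mem_triv_set (p : M) : p ∈ triv_set I F E p :=
  ⟨FiberBundle.mem_baseSet_trivializationAt' p, FiberBundle.mem_baseSet_trivializationAt' p⟩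

/-- A family of elements of `𝔇(E)_x` has smooth coordinates if its vector field is smooth and it
maps smooth sections to smooth sections. -/
theorem contMDiffAt_coordMap {q x₀ : M} (hx₀ : x₀ ∈ triv_set I F E q)
    {s : ∀ x, DerBundle I F E x}
    (hv : ContMDiffAt I (I.prod 𝓘(ℝ, EM)) ∞
      (fun x => (⟨x, (s x).vec⟩ : TotalSpace EM (TangentSpace I : M → Type _))) x₀)
    (ho : ∀ ψ : Cₛ^∞⟮I; F, E⟯, ContMDiffAt I (I.prod 𝓘(ℝ, F)) ∞
      (fun x => (⟨x, (s x).op ψ⟩ : TotalSpace F E)) x₀) :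
    ContMDiffAt I 𝓘(ℝ, EM × (F →L[ℝ] F)) ∞ (fun x => coordMap q x (s x)) x₀ := by
  have : IsManifold I ((((⊤ : ℕ∞) : ℕ∞) : WithTop ℕ∞) + 1) M := ‹IsManifold I ∞ M›
  have hU := (isOpen_triv_set (I := I) (F := F) (E := E) q).mem_nhds hx₀
  have h1 : ContMDiffAt I 𝓘(ℝ, EM) ∞ (fun x => (coordMap q x (s x)).1) x₀ := by
    refine ((contMDiffAt_localRep_iff (F := EM) (E := (TangentSpace I : M → Type _)) hx₀.2).1
      hv).congr_of_eventuallyEq ?_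
    filter_upwards [hU] with x hx
    rw [localRep, vec_eq hx, Trivialization.continuousLinearMapAt_symmL _ hx.2,
      coordMap_of_mem hx]
  have h2 : ContMDiffAt I 𝓘(ℝ, F →L[ℝ] F) ∞ (fun x => (coordMap q x (s x)).2) x₀ := by
    obtain ⟨χ, S, hχ, -, hS⟩ := exists_localFrame (I := I) (F := F) (E := E) hx₀.1
    refine contMDiffAt_clm_of_apply fun w => ?_
    refine ((contMDiffAt_localRep_iff hx₀.1).1 (ho (S w))).congr_of_eventuallyEq ?_
    filter_upwards [hU, eventually_eventually_nhds.2 (localRep_localFrame hx₀.1 hχ hS w)]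
      with x hx hx'
    have hx'' : localRep F q (S w) =ᶠ[𝓝 x] fun _ => w := hx'
    rw [coordMap_of_mem hx, localRep, op_eq hx, hx''.self_of_nhds, mvfderiv_congr hx'',
      mvfderiv_const]
    simp
  exact h1.prodMk_space h2

/-- Converse of `contMDiffAt_coordMap`. -/
theorem contMDiffAt_of_coordMap {q x₀ : M} (hx₀ : x₀ ∈ triv_set I F E q)
    {s : ∀ x, DerBundle I F E x}
    (hs : ContMDiffAt I 𝓘(ℝ, EM × (F →L[ℝ] F)) ∞ (fun x => coordMap q x (s x)) x₀) :
    ContMDiffAt I (I.prod 𝓘(ℝ, EM)) ∞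
      (fun x => (⟨x, (s x).vec⟩ : TotalSpace EM (TangentSpace I : M → Type _))) x₀ ∧
    ∀ ψ : Cₛ^∞⟮I; F, E⟯, ContMDiffAt I (I.prod 𝓘(ℝ, F)) ∞
      (fun x => (⟨x, (s x).op ψ⟩ : TotalSpace F E)) x₀ := by
  have : IsManifold I ((((⊤ : ℕ∞) : ℕ∞) : WithTop ℕ∞) + 1) M := ‹IsManifold I ∞ M›
  have hU := (isOpen_triv_set (I := I) (F := F) (E := E) q).mem_nhds hx₀
  have h1 : ContMDiffAt I 𝓘(ℝ, EM) ∞ (fun x => (coordMap q x (s x)).1) x₀ :=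
    (contDiff_fst.contMDiff (n := ∞)).contMDiffAt.comp x₀ hs
  have h2 : ContMDiffAt I 𝓘(ℝ, F →L[ℝ] F) ∞ (fun x => (coordMap q x (s x)).2) x₀ :=
    (contDiff_snd.contMDiff (n := ∞)).contMDiffAt.comp x₀ hs
  have hv : ContMDiffAt I (I.prod 𝓘(ℝ, EM)) ∞
      (fun x => (⟨x, (s x).vec⟩ : TotalSpace EM (TangentSpace I : M → Type _))) x₀ := by
    refine (contMDiffAt_localRep_iff (F := EM) (E := (TangentSpace I : M → Type _)) hx₀.2).2
      (h1.congr_of_eventuallyEq ?_)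
    filter_upwards [hU] with x hx
    rw [localRep, vec_eq hx, Trivialization.continuousLinearMapAt_symmL _ hx.2,
      coordMap_of_mem hx]
  refine ⟨hv, fun ψ => (contMDiffAt_localRep_iff hx₀.1).2 ?_⟩
  have h3 := (contMDiffAt_mvfderiv_apply (contMDiffAt_localRep hx₀.1 ψ) hv).add
    (h2.clm_apply (contMDiffAt_localRep hx₀.1 ψ))
  refine h3.congr_of_eventuallyEq ?_
  filter_upwards [hU] with x hx
  rw [localRep, op_eq hx, ← coordMap_of_mem hx]
  rfl

noncomputable instance instTopologicalSpaceFiber (x : M) : TopologicalSpace (DerBundle I F E x) :=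
  TopologicalSpace.induced (toModel x x (mem_triv_set x)) inferInstance

open Classical in
variable (I F E) in
/-- The local trivialization of `𝔇(E)` around `p`. -/
noncomputable def pretriv (p : M) :
    Pretrivialization (EM × (F →L[ℝ] F)) (π (EM × (F →L[ℝ] F)) (DerBundle I F E)) where
  toFun d := (d.1, coordMap p d.1 d.2)
  invFun y := ⟨y.1, if hx : y.1 ∈ triv_set I F E p then ofModel p y.1 hx y.2 else 0⟩
  source := π _ (DerBundle I F E) ⁻¹' triv_set I F E p
  target := triv_set I F E p ×ˢ Set.univ
  map_source' := fun d hd => ⟨hd, trivial⟩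
  map_target' := fun y hy => hy.1
  left_inv' := by
    rintro ⟨x, d⟩ (hx : x ∈ triv_set I F E p)
    simp [hx, coordMap_of_mem hx, ofModel_toModel]
  right_inv' := by
    rintro ⟨x, u⟩ ⟨hx : x ∈ triv_set I F E p, -⟩
    simp only [hx, coordMap_of_mem hx, dite_true]
    exact Prod.ext rfl ((LinearEquiv.ofBijective _ (ofModel_bijective p x hx)).symm_apply_apply u)
  open_target := (isOpen_triv_set p).prod isOpen_univ
  baseSet := triv_set I F E p
  open_baseSet := isOpen_triv_set p
  source_eq := rfl
  target_eq := rfl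
  proj_toFun := fun d _ => rfl

instance pretriv_isLinear (p : M) : (pretriv I F E p).IsLinear ℝ :=
  ⟨fun x _ => (coordMap p x).isLinear⟩

theorem pretriv_symm {p x : M} (hx : x ∈ triv_set I F E p) (u : EM × (F →L[ℝ] F)) :
    (pretriv I F E p).symm x u = ofModel p x hx u := by
  have h := (pretriv I F E p).symm_apply (b := x) hx u
  have h2 : (pretriv I F E p).toPartialEquiv.symm (x, u) = ⟨x, ofModel p x hx u⟩ := by
    classical
    change (⟨x, if hx : x ∈ triv_set I F E p then ofModel p x hx u else 0⟩ :
      TotalSpace _ (DerBundle I F E)) = _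
    simp [hx]
  rw [h]
  apply eq_of_heq
  refine (cast_heq _ _).trans ?_
  rw [h2]

/-- The coordinate changes of `𝔇(E)`. -/
noncomputable def coordChange (p q x : M) : (EM × (F →L[ℝ] F)) →L[ℝ] (EM × (F →L[ℝ] F)) :=
  open Classical in
  if hx : x ∈ triv_set I F E p then
    LinearMap.toContinuousLinearMap (coordMap q x ∘ₗ ofModel p x hx) else 0

variable (I F E) in
theorem contMDiffOn_coordChange (p q : M) :
    ContMDiffOn I 𝓘(ℝ, (EM × (F →L[ℝ] F)) →L[ℝ] (EM × (F →L[ℝ] F))) ∞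
      (coordChange (I := I) (F := F) (E := E) p q) (triv_set I F E p ∩ triv_set I F E q) := by
  classical
  intro x₀ hx₀
  refine (contMDiffAt_clm_of_apply fun u => ?_).contMDiffWithinAt
  let s : ∀ x, DerBundle I F E x := fun x =>
    if hx : x ∈ triv_set I F E p then ofModel p x hx u else 0
  have hs : ContMDiffAt I 𝓘(ℝ, EM × (F →L[ℝ] F)) ∞ (fun x => coordMap p x (s x)) x₀ := by
    refine (contMDiffAt_const (c := u)).congr_of_eventuallyEq ?_
    filter_upwards [(isOpen_triv_set (I := I) (F := F) (E := E) p).mem_nhds hx₀.1] with x hx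
    simp only [s, hx, coordMap_of_mem hx, dite_true]
    exact (LinearEquiv.ofBijective _ (ofModel_bijective p x hx)).symm_apply_apply u
  obtain ⟨h1, h2⟩ := contMDiffAt_of_coordMap hx₀.1 hs
  refine (contMDiffAt_coordMap hx₀.2 h1 h2).congr_of_eventuallyEq ?_
  filter_upwards [(isOpen_triv_set (I := I) (F := F) (E := E) p).mem_nhds hx₀.1] with x hx
  simp [s, coordChange, hx]

theorem coordChange_spec {p q x : M} (hx : x ∈ triv_set I F E p ∩ triv_set I F E q)
    (u : EM × (F →L[ℝ] F)) :
    coordChange (I := I) (F := F) (E := E) p q x u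
      = (pretriv I F E q ⟨x, (pretriv I F E p).symm x u⟩).2 := by
  rw [pretriv_symm hx.1]
  simp only [coordChange, hx.1, dite_true]
  rfl

variable (I F E) in
/-- The vector bundle structure of `𝔇(E)`. -/
noncomputable def prebundle : VectorPrebundle ℝ (EM × (F →L[ℝ] F)) (DerBundle I F E) where
  pretrivializationAtlas := Set.range (pretriv I F E)
  pretrivialization_linear' := by
    rintro _ ⟨p, rfl⟩
    infer_instance
  pretrivializationAt := pretriv I F E
  mem_base_pretrivializationAt := mem_triv_set
  pretrivialization_mem_atlas p := ⟨p, rfl⟩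
  exists_coordChange := by
    rintro _ ⟨p, rfl⟩ _ ⟨q, rfl⟩
    exact ⟨coordChange p q, (contMDiffOn_coordChange I F E p q).continuousOn,
      fun x hx u => coordChange_spec hx u⟩
  totalSpaceMk_isInducing x := by
    have h : ⇑(pretriv I F E x) ∘ TotalSpace.mk x = fun d => (x, toModel x x (mem_triv_set x) d) :=
      funext fun d => Prod.ext rfl (coordMap_of_mem _ d)
    rw [h]
    refine Topology.IsInducing.of_comp (g := Prod.snd) ?_ continuous_snd ⟨rfl⟩
    exact continuous_const.prodMk continuous_induced_dom

noncomputable instance : TopologicalSpace (TotalSpace (EM × (F →L[ℝ] F)) (DerBundle I F E)) :=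
  (prebundle I F E).totalSpaceTopology

noncomputable instance : FiberBundle (EM × (F →L[ℝ] F)) (DerBundle I F E) :=
  (prebundle I F E).toFiberBundle

instance : VectorBundle ℝ (EM × (F →L[ℝ] F)) (DerBundle I F E) :=
  (prebundle I F E).toVectorBundle

instance : (prebundle I F E).IsContMDiff I ∞ where
  exists_contMDiffCoordChange := by
    rintro _ ⟨p, rfl⟩ _ ⟨q, rfl⟩
    exact ⟨coordChange p q, contMDiffOn_coordChange I F E p q, fun x hx u => coordChange_spec hx u⟩

instance : ContMDiffVectorBundle ∞ (EM × (F →L[ℝ] F)) (DerBundle I F E) I :=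
  (prebundle I F E).contMDiffVectorBundle I

/-- A section of `𝔇(E)` is smooth if and only if its vector field is smooth and it maps smooth
sections of `E` to smooth sections of `E`. -/
theorem contMDiffAt_iff {x₀ : M} {s : ∀ x, DerBundle I F E x} :
    ContMDiffAt I (I.prod 𝓘(ℝ, EM × (F →L[ℝ] F))) ∞
      (fun x => (⟨x, s x⟩ : TotalSpace (EM × (F →L[ℝ] F)) (DerBundle I F E))) x₀ ↔
    ContMDiffAt I (I.prod 𝓘(ℝ, EM)) ∞
      (fun x => (⟨x, (s x).vec⟩ : TotalSpace EM (TangentSpace I : M → Type _))) x₀ ∧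
    ∀ ψ : Cₛ^∞⟮I; F, E⟯, ContMDiffAt I (I.prod 𝓘(ℝ, F)) ∞
      (fun x => (⟨x, (s x).op ψ⟩ : TotalSpace F E)) x₀ := by
  rw [contMDiffAt_section]
  exact ⟨fun h => contMDiffAt_of_coordMap (mem_triv_set x₀) h,
    fun h => contMDiffAt_coordMap (mem_triv_set x₀) h.1 h.2⟩

end DerBundle

end DerBundleStructure

section Algebroids

variable {EM : Type*} [NormedAddCommGroup EM] [NormedSpace ℝ EM]
  {H : Type*} [TopologicalSpace H] {I : ModelWithCorners ℝ EM H}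
  {M : Type*} [TopologicalSpace M] [ChartedSpace H M]
  {FA : Type*} [NormedAddCommGroup FA] [NormedSpace ℝ FA]
  {A : M → Type*} [TopologicalSpace (TotalSpace FA A)] [∀ x, AddCommGroup (A x)]
  [∀ x, Module ℝ (A x)] [∀ x, TopologicalSpace (A x)] [FiberBundle FA A] [VectorBundle ℝ FA A]
  {FB : Type*} [NormedAddCommGroup FB] [NormedSpace ℝ FB]
  {B : M → Type*} [TopologicalSpace (TotalSpace FB B)] [∀ x, AddCommGroup (B x)]
  [∀ x, Module ℝ (B x)] [∀ x, TopologicalSpace (B x)] [FiberBundle FB B] [VectorBundle ℝ FB B]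

variable (I FA A FB B) in
/-- A morphism of smooth vector bundles over the identity of `M`. -/
structure VBHom where
  /-- The linear maps on the fibres. -/
  toFun : ∀ x, A x →ₗ[ℝ] B x
  contMDiff_total : ContMDiff (I.prod 𝓘(ℝ, FA)) (I.prod 𝓘(ℝ, FB)) ∞
    (fun p : TotalSpace FA A => (⟨p.proj, toFun p.proj p.snd⟩ : TotalSpace FB B))

/-- The map induced on smooth sections by a morphism of vector bundles. -/
noncomputable def VBHom.mapSec (φ : VBHom I FA A FB B) : Cₛ^∞⟮I; FA, A⟯ →ₗ[ℝ] Cₛ^∞⟮I; FB, B⟯ where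
  toFun s := ⟨fun x => φ.toFun x (s x), φ.contMDiff_total.comp s.contMDiff⟩
  map_add' s t := by
    ext x
    exact map_add (φ.toFun x) (s x) (t x)
  map_smul' c s := by
    ext x
    exact map_smul (φ.toFun x) c (s x)

theorem VBHom.mapSec_apply (φ : VBHom I FA A FB B) (s : Cₛ^∞⟮I; FA, A⟯) (x : M) :
    φ.mapSec s x = φ.toFun x (s x) := rfl

theorem VBHom.mapSec_fsmul (φ : VBHom I FA A FB B) (f : C^∞⟮I, M; 𝓘(ℝ, ℝ), ℝ⟯)
    (s : Cₛ^∞⟮I; FA, A⟯) : φ.mapSec (f • s) = f • φ.mapSec s := by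
  ext x
  exact map_smul (φ.toFun x) (f x) (s x)

/-- A family of linear maps that maps smooth sections to smooth sections is a smooth map. -/
theorem contMDiff_total_of_sections [FiniteDimensional ℝ EM] [IsManifold I ∞ M] [T2Space M]
    [FiniteDimensional ℝ FA] [ContMDiffVectorBundle ∞ FA A I] [ContMDiffVectorBundle ∞ FB B I]
    (φ : ∀ x, A x →ₗ[ℝ] B x)
    (h : ∀ s : Cₛ^∞⟮I; FA, A⟯, ContMDiff I (I.prod 𝓘(ℝ, FB)) ∞
      (fun x => (⟨x, φ x (s x)⟩ : TotalSpace FB B))) :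
    ContMDiff (I.prod 𝓘(ℝ, FA)) (I.prod 𝓘(ℝ, FB)) ∞
      (fun p : TotalSpace FA A => (⟨p.proj, φ p.proj p.snd⟩ : TotalSpace FB B)) := by
  intro p₀
  set e := trivializationAt FA A p₀.proj
  set e' := trivializationAt FB B p₀.proj
  have hp := FiberBundle.mem_baseSet_trivializationAt FA A p₀.proj
  have hp' := FiberBundle.mem_baseSet_trivializationAt FB B p₀.proj
  have hid : ContMDiffAt (I.prod 𝓘(ℝ, FA)) (I.prod 𝓘(ℝ, FA)) ∞
    (fun p : TotalSpace FA A => p) p₀ := contMDiffAt_id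
  rw [contMDiffAt_totalSpace] at hid ⊢
  refine ⟨hid.1, ?_⟩
  obtain ⟨χ, S, hχ, -, hS⟩ := exists_localFrame (I := I) hp
  let b := Module.finBasis ℝ FA
  have hsm : ContMDiffAt (I.prod 𝓘(ℝ, FA)) 𝓘(ℝ, FB) ∞ (fun p : TotalSpace FA A =>
      ∑ i, b.coord i (e p).2 • localRep FB p₀.proj (fun y => φ y (S (b i) y)) p.proj) p₀ := by
    refine ContMDiffAt.sum fun i _ => ?_
    have h1 : ContMDiffAt (I.prod 𝓘(ℝ, FA)) 𝓘(ℝ, ℝ) ∞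
        (fun p : TotalSpace FA A => b.coord i (e p).2) p₀ :=
      (LinearMap.toContinuousLinearMap (b.coord i)).contMDiff.contMDiffAt.comp p₀ hid.2
    have h2 : ContMDiffAt (I.prod 𝓘(ℝ, FA)) 𝓘(ℝ, FB) ∞ (fun p : TotalSpace FA A =>
        localRep FB p₀.proj (fun y => φ y (S (b i) y)) p.proj) p₀ :=
      ContMDiffAt.comp p₀ ((contMDiffAt_localRep_iff hp').1 (h (S (b i)) p₀.proj)) hid.1
    exact h1.smul h2
  refine hsm.congr_of_eventuallyEq ?_
  have hc : Filter.Tendsto (fun p : TotalSpace FA A => p.proj) (𝓝 p₀) (𝓝 p₀.proj) :=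
    hid.1.continuousAt
  filter_upwards [hc.eventually (e.open_baseSet.mem_nhds hp),
    hc.eventually (e'.open_baseSet.mem_nhds hp'), hc.eventually hχ] with p h1 h2 h3
  have h4 (v : B p.proj) : (e' ⟨p.proj, v⟩).2 = e'.continuousLinearMapAt ℝ p.proj v :=
    (congrFun (e'.coe_linearMapAt_of_mem (R := ℝ) h2) v).symm
  have h5 : p.snd = e.symmL ℝ p.proj (e p).2 := by
    have : (e p).2 = e.continuousLinearMapAt ℝ p.proj p.snd :=
      (congrFun (e.coe_linearMapAt_of_mem (R := ℝ) h1) p.snd).symm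
    rw [this, e.symmL_continuousLinearMapAt h1]
  have h6 (i) : S (b i) p.proj = e.symmL ℝ p.proj (b i) := by
    rw [hS, h3, Pi.one_apply, one_smul]
  change (e' ⟨p.proj, φ p.proj p.snd⟩).2 = _
  rw [h4, h5]
  conv_lhs => rw [← b.sum_repr (e p).2]
  simp only [map_sum, map_smul, localRep, h6]
  rfl

variable [FiniteDimensional ℝ EM] [IsManifold I ∞ M]

namespace SmoothVectorField

theorem bracket_add_right (X Y Z : SmoothVectorField I M) :
    X.bracket (Y + Z) = X.bracket Y + X.bracket Z := by
  ext x
  exact VectorField.mlieBracket_add_right (Y.mdiffAt x) (Z.mdiffAt x)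

theorem bracket_swap (X Y : SmoothVectorField I M) : X.bracket Y = - Y.bracket X := by
  ext x
  exact congrFun (VectorField.mlieBracket_swap (I := I) (V := X) (W := Y)) x

theorem bracket_add_left (X Y Z : SmoothVectorField I M) :
    (X + Y).bracket Z = X.bracket Z + Y.bracket Z := by
  rw [bracket_swap, bracket_add_right, neg_add, ← bracket_swap, ← bracket_swap]

theorem bracket_fsmul_right (X Y : SmoothVectorField I M) (f : C^∞⟮I, M; 𝓘(ℝ, ℝ), ℝ⟯) :
    X.bracket (f • Y) = f • X.bracket Y + X.deriv f • Y := by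
  ext x
  rw [add_comm]
  exact VectorField.mlieBracket_smul_right ((f.contMDiff x).mdifferentiableAt (by simp))
    (Y.mdiffAt x)

theorem bracket_smul_right (c : ℝ) (X Y : SmoothVectorField I M) :
    X.bracket (c • Y) = c • X.bracket Y := by
  ext x
  exact VectorField.mlieBracket_const_smul_right (Y.mdiffAt x)

theorem bracket_smul_left (c : ℝ) (X Y : SmoothVectorField I M) :
    (c • X).bracket Y = c • X.bracket Y := by
  rw [bracket_swap, bracket_smul_right, ← smul_neg, ← bracket_swap]

theorem jacobi_cyclic (X Y Z : SmoothVectorField I M) :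
    X.bracket (Y.bracket Z) + Y.bracket (Z.bracket X) + Z.bracket (X.bracket Y) = 0 := by
  rw [jacobi, bracket_swap Z X, bracket_swap Z (X.bracket Y), ← neg_one_smul ℝ (X.bracket Z),
    bracket_smul_right]
  module

theorem bracket_self (X : SmoothVectorField I M) : X.bracket X = 0 := by
  ext x
  simp [bracket_apply]

end SmoothVectorField

variable (I FA A) in
/-- A Lie algebroid structure on the vector bundle `A` over `M`. -/
structure LieAlgebroid where
  /-- The anchor `A → TM`. -/
  anchor : VBHom I FA A EM (TangentSpace I : M → Type _)
  /-- The bracket of smooth sections. -/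
  bracket : Cₛ^∞⟮I; FA, A⟯ →ₗ[ℝ] Cₛ^∞⟮I; FA, A⟯ →ₗ[ℝ] Cₛ^∞⟮I; FA, A⟯
  bracket_self : ∀ s, bracket s s = 0
  jacobi : ∀ s t u,
    bracket s (bracket t u) + bracket t (bracket u s) + bracket u (bracket s t) = 0
  anchor_bracket : ∀ s t, anchor.mapSec (bracket s t)
    = SmoothVectorField.bracket (anchor.mapSec s) (anchor.mapSec t)
  leibniz : ∀ (s : Cₛ^∞⟮I; FA, A⟯) (f : C^∞⟮I, M; 𝓘(ℝ, ℝ), ℝ⟯) (t : Cₛ^∞⟮I; FA, A⟯),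
    bracket s (f • t) = f • bracket s t + SmoothVectorField.deriv (anchor.mapSec s) f • t

/-- A morphism of Lie algebroids over (the identity of) `M`. -/
structure LieAlgebroid.Hom (𝒜 : LieAlgebroid I FA A) (ℬ : LieAlgebroid I FB B) extends
    VBHom I FA A FB B where
  anchor_comp : ∀ x a, ℬ.anchor.toFun x (toFun x a) = 𝒜.anchor.toFun x a
  map_bracket : ∀ s t, toVBHom.mapSec (𝒜.bracket s t)
    = ℬ.bracket (toVBHom.mapSec s) (toVBHom.mapSec t)

end Algebroids

section DerivationAlgebroid

variable {EM : Type*} [NormedAddCommGroup EM] [NormedSpace ℝ EM] [FiniteDimensional ℝ EM]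
  {H : Type*} [TopologicalSpace H] {I : ModelWithCorners ℝ EM H}
  {M : Type*} [TopologicalSpace M] [ChartedSpace H M] [IsManifold I ∞ M] [T2Space M]
  {F : Type*} [NormedAddCommGroup F] [NormedSpace ℝ F] [FiniteDimensional ℝ F]
  {E : M → Type*} [TopologicalSpace (TotalSpace F E)] [∀ x, AddCommGroup (E x)]
  [∀ x, Module ℝ (E x)] [∀ x, TopologicalSpace (E x)] [FiberBundle F E] [VectorBundle ℝ F E]
  [ContMDiffVectorBundle ∞ F E I]

namespace DerBundle

variable (I F E) in
/-- The anchor of `𝔇(E)`. -/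
noncomputable def anchor :
    VBHom I (EM × (F →L[ℝ] F)) (DerBundle I F E) EM (TangentSpace I : M → Type _) where
  toFun _ := vec
  contMDiff_total := by
    have : IsManifold I ((((⊤ : ℕ∞) : ℕ∞) : WithTop ℕ∞) + 1) M := ‹IsManifold I ∞ M›
    exact contMDiff_total_of_sections _ fun s x => (contMDiffAt_iff.1 (s.contMDiff x)).1

/-- The operator on `ΓE` defined by a smooth section of `𝔇(E)`. -/
noncomputable def act (s : Cₛ^∞⟮I; EM × (F →L[ℝ] F), DerBundle I F E⟯) :
    Module.End ℝ Cₛ^∞⟮I; F, E⟯ where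
  toFun ψ := ⟨fun x => (s x).op ψ, fun x => (contMDiffAt_iff.1 (s.contMDiff x)).2 ψ⟩
  map_add' ψ φ := by
    ext x
    exact map_add (s x).op ψ φ
  map_smul' c ψ := by
    ext x
    exact map_smul (s x).op c ψ

theorem act_apply (s : Cₛ^∞⟮I; EM × (F →L[ℝ] F), DerBundle I F E⟯) (ψ : Cₛ^∞⟮I; F, E⟯) (x : M) :
    act s ψ x = (s x).op ψ := rfl

theorem act_fsmul (s : Cₛ^∞⟮I; EM × (F →L[ℝ] F), DerBundle I F E⟯)
    (f : C^∞⟮I, M; 𝓘(ℝ, ℝ), ℝ⟯) (ψ : Cₛ^∞⟮I; F, E⟯) :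
    act s (f • ψ) = f • act s ψ + SmoothVectorField.deriv ((anchor I F E).mapSec s) f • ψ := by
  ext x
  exact (s x).op_fsmul f ψ

theorem section_ext {s t : Cₛ^∞⟮I; EM × (F →L[ℝ] F), DerBundle I F E⟯}
    (h : (anchor I F E).mapSec s = (anchor I F E).mapSec t) (h' : act s = act t) : s = t := by
  ext x
  refine DerBundle.ext (congrArg (fun v => v x) h) (LinearMap.ext fun ψ => ?_)
  exact congrArg (fun v => v ψ x) h'

/-- The bracket of sections of `𝔇(E)`: the commutator of operators. -/
noncomputable def bracket (s t : Cₛ^∞⟮I; EM × (F →L[ℝ] F), DerBundle I F E⟯) :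
    Cₛ^∞⟮I; EM × (F →L[ℝ] F), DerBundle I F E⟯ :=
  ⟨fun x => mk
      (SmoothVectorField.bracket ((anchor I F E).mapSec s) ((anchor I F E).mapSec t) x)
      (ContMDiffSection.evalAt x ∘ₗ ⁅act s, act t⁆)
      (fun f ψ => by
        have h := SmoothVectorField.deriv_bracket_real ((anchor I F E).mapSec s)
          ((anchor I F E).mapSec t) f
        have h' := congrArg (fun g => g x) h
        change mvfderiv I f x _ = _ at h'
        rw [h']
        change (act s (act t (f • ψ)) - act t (act s (f • ψ))) x
          = f x • (act s (act t ψ) - act t (act s ψ)) x + _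
        simp only [act_fsmul, map_add, ContMDiffSection.coe_sub, ContMDiffSection.coe_add,
          Pi.add_apply, Pi.sub_apply, ContMDiffSection.fsmul_apply, ContMDiffMap.coe_sub, sub_smul,
          smul_sub]
        abel),
    fun x => contMDiffAt_iff.2 ⟨SmoothVectorField.contMDiffAt (SmoothVectorField.bracket ((anchor I F E).mapSec s)
      ((anchor I F E).mapSec t)) x,
      fun ψ => (⁅act s, act t⁆ ψ).contMDiff x⟩⟩

theorem anchor_bracket (s t : Cₛ^∞⟮I; EM × (F →L[ℝ] F), DerBundle I F E⟯) :
    (anchor I F E).mapSec (bracket s t)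
      = SmoothVectorField.bracket ((anchor I F E).mapSec s) ((anchor I F E).mapSec t) := rfl

theorem act_bracket (s t : Cₛ^∞⟮I; EM × (F →L[ℝ] F), DerBundle I F E⟯) :
    act (bracket s t) = ⁅act s, act t⁆ := rfl

theorem act_add (s t : Cₛ^∞⟮I; EM × (F →L[ℝ] F), DerBundle I F E⟯) :
    act (s + t) = act s + act t := by
  ext ψ x
  exact congrArg (fun L => L ψ) (map_add op (s x) (t x))

theorem act_smul (c : ℝ) (s : Cₛ^∞⟮I; EM × (F →L[ℝ] F), DerBundle I F E⟯) :
    act (c • s) = c • act s := by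
  ext ψ x
  exact congrArg (fun L => L ψ) (map_smul op c (s x))

end DerBundle

variable (I F E) in
/-- The Lie algebroid `𝔇(E)`. -/
noncomputable def derivationAlgebroid :
    LieAlgebroid I (EM × (F →L[ℝ] F)) (DerBundle I F E) where
  anchor := DerBundle.anchor I F E
  bracket := LinearMap.mk₂ ℝ DerBundle.bracket
    (fun s s' t => DerBundle.section_ext
      (by simp only [DerBundle.anchor_bracket, map_add, SmoothVectorField.bracket_add_left])
      (by simp only [DerBundle.act_bracket, DerBundle.act_add, add_lie]))
    (fun c s t => DerBundle.section_ext
      (by simp only [DerBundle.anchor_bracket, map_smul, SmoothVectorField.bracket_smul_left])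
      (by simp only [DerBundle.act_bracket, DerBundle.act_smul, smul_lie]))
    (fun s t t' => DerBundle.section_ext
      (by simp only [DerBundle.anchor_bracket, map_add, SmoothVectorField.bracket_add_right])
      (by simp only [DerBundle.act_bracket, DerBundle.act_add, lie_add]))
    (fun c s t => DerBundle.section_ext
      (by simp only [DerBundle.anchor_bracket, map_smul, SmoothVectorField.bracket_smul_right])
      (by simp only [DerBundle.act_bracket, DerBundle.act_smul, lie_smul]))
  bracket_self s := DerBundle.section_ext
    (by
      simp only [LinearMap.mk₂_apply, DerBundle.anchor_bracket, SmoothVectorField.bracket_self,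
        map_zero])
    (by
      simp only [LinearMap.mk₂_apply, DerBundle.act_bracket, lie_self]
      rfl)
  jacobi s t u := DerBundle.section_ext
    (by
      simp only [LinearMap.mk₂_apply, DerBundle.anchor_bracket, map_add, map_zero]
      exact SmoothVectorField.jacobi_cyclic _ _ _)
    (by
      simp only [LinearMap.mk₂_apply, DerBundle.act_bracket, DerBundle.act_add, lie_jacobi]
      rfl)
  anchor_bracket s t := DerBundle.anchor_bracket s t
  leibniz s f t := DerBundle.section_ext
    (by
      simp only [LinearMap.mk₂_apply, DerBundle.anchor_bracket, map_add,
        VBHom.mapSec_fsmul]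
      exact SmoothVectorField.bracket_fsmul_right _ _ f)
    (by
      ext ψ x
      simp only [LinearMap.mk₂_apply]
      have h1 (u : Cₛ^∞⟮I; EM × (F →L[ℝ] F), DerBundle I F E⟯) (g : C^∞⟮I, M; 𝓘(ℝ, ℝ), ℝ⟯)
          (φ : Cₛ^∞⟮I; F, E⟯) : DerBundle.act (g • u) φ = g • DerBundle.act u φ := by
        ext y
        exact congrArg (fun L => L φ) (map_smul DerBundle.op (g y) (u y))
      simp only [DerBundle.act_bracket, DerBundle.act_add, LieRing.of_associative_ring_bracket,
        LinearMap.sub_apply, LinearMap.add_apply, Module.End.mul_apply, h1, DerBundle.act_fsmul,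
        ContMDiffSection.coe_sub, ContMDiffSection.coe_add, Pi.add_apply, Pi.sub_apply,
        ContMDiffSection.fsmul_apply, smul_sub]
      abel)

end DerivationAlgebroid

section LieModel

/-- A copy of the vector space underlying a finite-dimensional Lie algebra `𝔤`, which carries a
norm (any norm defines the standard smooth structure), so that it can serve as the fibre of the
trivial bundle `M × 𝔤`. -/
def LieModel (𝔤 : Type*) : Type _ := 𝔤

variable {𝔤 : Type*} [LieRing 𝔤] [LieAlgebra ℝ 𝔤]

namespace LieModel

instance : AddCommGroup (LieModel 𝔤) := inferInstanceAs (AddCommGroup 𝔤)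

instance : Module ℝ (LieModel 𝔤) := inferInstanceAs (Module ℝ 𝔤)

/-- The identity map. -/
def of : 𝔤 ≃ₗ[ℝ] LieModel 𝔤 := LinearEquiv.refl ℝ 𝔤

variable [FiniteDimensional ℝ 𝔤]

instance : FiniteDimensional ℝ (LieModel 𝔤) := inferInstanceAs (FiniteDimensional ℝ 𝔤)

noncomputable instance : NormedAddCommGroup (LieModel 𝔤) :=
  NormedAddCommGroup.induced (LieModel 𝔤) (Fin (finrank ℝ (LieModel 𝔤)) → ℝ)
    (finBasis ℝ (LieModel 𝔤)).equivFun (finBasis ℝ (LieModel 𝔤)).equivFun.injective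

noncomputable instance : NormedSpace ℝ (LieModel 𝔤) :=
  NormedSpace.induced ℝ (LieModel 𝔤) (Fin (finrank ℝ (LieModel 𝔤)) → ℝ)
    (finBasis ℝ (LieModel 𝔤)).equivFun

variable (𝔤) in
/-- The Lie bracket of `𝔤`, as a continuous bilinear map. -/
noncomputable def lie : LieModel 𝔤 →L[ℝ] LieModel 𝔤 →L[ℝ] LieModel 𝔤 :=
  (LinearMap.mk₂ ℝ (fun u v : LieModel 𝔤 => of ⁅of.symm u, of.symm v⁆)
    (fun u u' v => by simp) (fun c u v => by simp) (fun u v v' => by simp)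
    (fun c u v => by simp)).toContinuousBilinearMap

theorem lie_apply (u v : LieModel 𝔤) : lie 𝔤 u v = of ⁅of.symm u, of.symm v⁆ := rfl

end LieModel

end LieModel

section ActionAlgebroid

variable {EM : Type*} [NormedAddCommGroup EM] [NormedSpace ℝ EM] [FiniteDimensional ℝ EM]
  {H : Type*} [TopologicalSpace H] {I : ModelWithCorners ℝ EM H}
  {M : Type*} [TopologicalSpace M] [ChartedSpace H M] [IsManifold I ∞ M]
  {𝔤 : Type*} [LieRing 𝔤] [LieAlgebra ℝ 𝔤]

variable (I M 𝔤) in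
/-- An infinitesimal action `X ↦ X_M` of the Lie algebra `𝔤` on `M`. -/
structure InfinitesimalAction where
  /-- The vector field `X_M`. -/
  toFun : 𝔤 →ₗ[ℝ] SmoothVectorField I M
  map_lie : ∀ X Y, toFun ⁅X, Y⁆ = (toFun X).bracket (toFun Y)

variable [FiniteDimensional ℝ 𝔤]

/-- A section of the trivial bundle `M × 𝔤`, as a function on `M`. -/
noncomputable def ContMDiffSection.toMap :
    Cₛ^∞⟮I; LieModel 𝔤, Bundle.Trivial M (LieModel 𝔤)⟯ ≃ₗ[ℝ]
      C^∞⟮I, M; 𝓘(ℝ, LieModel 𝔤), LieModel 𝔤⟯ where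
  toFun V := ⟨fun x => V x, fun x => (contMDiffAt_section x).1 (V.contMDiff x)⟩
  invFun V := ⟨fun x => V x, fun x => (contMDiffAt_section x).2 (V.contMDiff x)⟩
  map_add' _ _ := rfl
  map_smul' _ _ := rfl
  left_inv _ := rfl
  right_inv _ := rfl

theorem ContMDiffSection.toMap_apply
    (V : Cₛ^∞⟮I; LieModel 𝔤, Bundle.Trivial M (LieModel 𝔤)⟯) (x : M) :
    ContMDiffSection.toMap V x = V x := rfl

/-- The pointwise bracket of functions with values in `𝔤`. -/
noncomputable def pointwiseLie :
    C^∞⟮I, M; 𝓘(ℝ, LieModel 𝔤), LieModel 𝔤⟯ →ₗ[ℝ] C^∞⟮I, M; 𝓘(ℝ, LieModel 𝔤), LieModel 𝔤⟯ →ₗ[ℝ]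
      C^∞⟮I, M; 𝓘(ℝ, LieModel 𝔤), LieModel 𝔤⟯ :=
  LinearMap.mk₂ ℝ (fun V W => ⟨fun x => LieModel.lie 𝔤 (V x) (W x), fun x =>
      (((LieModel.lie 𝔤).contMDiff.contMDiffAt.comp x (V.contMDiff x)).clm_apply (W.contMDiff x))⟩)
    (fun V V' W => ContMDiffMap.ext fun x => (LieModel.lie 𝔤).map_add₂ (V x) (V' x) (W x))
    (fun c V W => ContMDiffMap.ext fun x => (LieModel.lie 𝔤).map_smul₂ c (V x) (W x))
    (fun V W W' => ContMDiffMap.ext fun x => map_add (LieModel.lie 𝔤 (V x)) (W x) (W' x))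
    (fun c V W => ContMDiffMap.ext fun x => map_smul (LieModel.lie 𝔤 (V x)) c (W x))

theorem pointwiseLie_apply (V W : C^∞⟮I, M; 𝓘(ℝ, LieModel 𝔤), LieModel 𝔤⟯) (x : M) :
    pointwiseLie V W x = LieModel.of ⁅LieModel.of.symm (V x), LieModel.of.symm (W x)⁆ := rfl

namespace SmoothVectorField

variable {W : Type*} [NormedAddCommGroup W] [NormedSpace ℝ W]

theorem deriv_add_right (X : SmoothVectorField I M) (f g : C^∞⟮I, M; 𝓘(ℝ, W), W⟯) :
    X.deriv (f + g) = X.deriv f + X.deriv g := by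
  ext x
  have := mvfderiv_add ((f.contMDiff x).mdifferentiableAt (by simp))
    ((g.contMDiff x).mdifferentiableAt (by simp))
  exact congrArg (fun L => L (X x)) this

theorem deriv_fsmul_right (X : SmoothVectorField I M) (f : C^∞⟮I, M; 𝓘(ℝ, ℝ), ℝ⟯)
    (g : C^∞⟮I, M; 𝓘(ℝ, W), W⟯) (x : M) :
    mvfderiv I (fun y => f y • g y) x (X x) = f x • X.deriv g x + X.deriv f x • g x := by
  have := mvfderiv_smul ((f.contMDiff x).mdifferentiableAt (by simp))
    ((g.contMDiff x).mdifferentiableAt (by simp))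
  exact congrArg (fun L => L (X x)) this

theorem deriv_smul_right (X : SmoothVectorField I M) (c : ℝ) (g : C^∞⟮I, M; 𝓘(ℝ, W), W⟯) :
    X.deriv (c • g) = c • X.deriv g := by
  ext x
  have := mvfderiv_clm_comp (c • ContinuousLinearMap.id ℝ W)
    ((g.contMDiff x).mdifferentiableAt (by simp)) (X x)
  exact this

theorem deriv_add_left (X Y : SmoothVectorField I M) (f : C^∞⟮I, M; 𝓘(ℝ, W), W⟯) :
    (X + Y).deriv f = X.deriv f + Y.deriv f := by
  ext x
  exact map_add (mvfderiv I f x) (X x) (Y x)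

theorem deriv_smul_left (c : ℝ) (X : SmoothVectorField I M) (f : C^∞⟮I, M; 𝓘(ℝ, W), W⟯) :
    (c • X).deriv f = c • X.deriv f := by
  ext x
  exact map_smul (mvfderiv I f x) c (X x)

theorem deriv_sub_right (X : SmoothVectorField I M) (f g : C^∞⟮I, M; 𝓘(ℝ, W), W⟯) :
    X.deriv (f - g) = X.deriv f - X.deriv g := by
  rw [sub_eq_add_neg, deriv_add_right, ← neg_one_smul ℝ g, deriv_smul_right]
  module

theorem deriv_pointwiseLie (X : SmoothVectorField I M)
    (V W : C^∞⟮I, M; 𝓘(ℝ, LieModel 𝔤), LieModel 𝔤⟯) :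
    X.deriv (pointwiseLie V W) = pointwiseLie (X.deriv V) W + pointwiseLie V (X.deriv W) := by
  ext x
  exact mvfderiv_bilin (LieModel.lie 𝔤) ((V.contMDiff x).mdifferentiableAt (by simp))
    ((W.contMDiff x).mdifferentiableAt (by simp)) (X x)

end SmoothVectorField

theorem pointwiseLie_self (V : C^∞⟮I, M; 𝓘(ℝ, LieModel 𝔤), LieModel 𝔤⟯) :
    pointwiseLie V V = 0 := by
  ext x
  simp [pointwiseLie_apply]

theorem pointwiseLie_swap (V W : C^∞⟮I, M; 𝓘(ℝ, LieModel 𝔤), LieModel 𝔤⟯) :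
    pointwiseLie V W = - pointwiseLie W V := by
  ext x
  rw [ContMDiffMap.coe_neg, Pi.neg_apply, pointwiseLie_apply, pointwiseLie_apply, ← lie_skew,
    map_neg]

theorem pointwiseLie_jacobi (V W U : C^∞⟮I, M; 𝓘(ℝ, LieModel 𝔤), LieModel 𝔤⟯) :
    pointwiseLie V (pointwiseLie W U) + pointwiseLie W (pointwiseLie U V)
      + pointwiseLie U (pointwiseLie V W) = 0 := by
  ext x
  simp only [ContMDiffMap.coe_add, Pi.add_apply, pointwiseLie_apply, LinearEquiv.symm_apply_apply,
    ← map_add, lie_jacobi, map_zero]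
  rfl

namespace InfinitesimalAction

variable (act : InfinitesimalAction I M 𝔤)

theorem map_eq_sum {V : Type*} [AddCommGroup V] [Module ℝ V] (L : 𝔤 →ₗ[ℝ] V) (w : LieModel 𝔤) :
    L (LieModel.of.symm w) = ∑ i, (finBasis ℝ (LieModel 𝔤)).coord i w •
      L (LieModel.of.symm (finBasis ℝ (LieModel 𝔤) i)) := by
  conv_lhs => rw [← (finBasis ℝ (LieModel 𝔤)).sum_repr w]
  simp only [map_sum, map_smul, Basis.coord_apply]

/-- The coordinates of a section of `M × 𝔤`. -/
noncomputable def coordFun (V : Cₛ^∞⟮I; LieModel 𝔤, Bundle.Trivial M (LieModel 𝔤)⟯)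
    (i : Fin (finrank ℝ (LieModel 𝔤))) : C^∞⟮I, M; 𝓘(ℝ, ℝ), ℝ⟯ :=
  ⟨fun x => (finBasis ℝ (LieModel 𝔤)).coord i (ContMDiffSection.toMap V x),
    (LinearMap.toContinuousLinearMap ((finBasis ℝ (LieModel 𝔤)).coord i)).contMDiff.comp
      (ContMDiffSection.toMap V).contMDiff⟩

theorem sum_apply (V : Cₛ^∞⟮I; LieModel 𝔤, Bundle.Trivial M (LieModel 𝔤)⟯) (x : M) :
    (∑ i, coordFun V i • act.toFun (LieModel.of.symm (finBasis ℝ (LieModel 𝔤) i))) x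
      = act.toFun (LieModel.of.symm (V x)) x := by
  have h3 : (∑ i, coordFun V i • act.toFun (LieModel.of.symm (finBasis ℝ (LieModel 𝔤) i))) x
    = ∑ i, coordFun V i x • act.toFun (LieModel.of.symm (finBasis ℝ (LieModel 𝔤) i)) x :=
      map_sum (ContMDiffSection.evalAt (I := I) (F := EM)
        (E := (TangentSpace I : M → Type _)) x)
        (fun i => coordFun V i • act.toFun (LieModel.of.symm (finBasis ℝ (LieModel 𝔤) i)))
        Finset.univ
  rw [h3]
  exact (map_eq_sum (ContMDiffSection.evalAt (I := I) (F := EM)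
      (E := (TangentSpace I : M → Type _)) x ∘ₗ act.toFun) (V x)).symm

theorem contMDiff_anchor (V : Cₛ^∞⟮I; LieModel 𝔤, Bundle.Trivial M (LieModel 𝔤)⟯) :
    ContMDiff I (I.prod 𝓘(ℝ, EM)) ∞
      (fun x => (⟨x, act.toFun (LieModel.of.symm (V x)) x⟩ :
        TotalSpace EM (TangentSpace I : M → Type _))) := by
  have h := (∑ i, coordFun V i • act.toFun
    (LieModel.of.symm (finBasis ℝ (LieModel 𝔤) i))).contMDiff
  simpa only [sum_apply] using h

/-- The anchor `(m, X) ↦ X_M(m)` of the action Lie algebroid. -/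
noncomputable def anchor [T2Space M] :
    VBHom I (LieModel 𝔤) (Bundle.Trivial M (LieModel 𝔤)) EM (TangentSpace I : M → Type _) where
  toFun x := ContMDiffSection.evalAt x ∘ₗ act.toFun ∘ₗ LieModel.of.symm.toLinearMap
  contMDiff_total := by
    have : IsManifold I ((((⊤ : ℕ∞) : ℕ∞) : WithTop ℕ∞) + 1) M := ‹IsManifold I ∞ M›
    exact contMDiff_total_of_sections (I := I) (FA := LieModel 𝔤)
      (A := Bundle.Trivial M (LieModel 𝔤)) (FB := EM) (B := (TangentSpace I : M → Type _))
      (fun x => ContMDiffSection.evalAt x ∘ₗ act.toFun ∘ₗ LieModel.of.symm.toLinearMap)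
      act.contMDiff_anchor

theorem anchor_apply [T2Space M] (x : M) (X : LieModel 𝔤) :
    act.anchor.toFun x X = act.toFun (LieModel.of.symm X) x := rfl

/-- `[V, W] = V_M(W) - W_M(V) + [V, W]^•`. -/
noncomputable def bracket [T2Space M] :
    Cₛ^∞⟮I; LieModel 𝔤, Bundle.Trivial M (LieModel 𝔤)⟯ →ₗ[ℝ]
      Cₛ^∞⟮I; LieModel 𝔤, Bundle.Trivial M (LieModel 𝔤)⟯ →ₗ[ℝ]
        Cₛ^∞⟮I; LieModel 𝔤, Bundle.Trivial M (LieModel 𝔤)⟯ :=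
  LinearMap.mk₂ ℝ (fun V W => ContMDiffSection.toMap.symm
    (SmoothVectorField.deriv (act.anchor.mapSec V) (ContMDiffSection.toMap W)
      - SmoothVectorField.deriv (act.anchor.mapSec W) (ContMDiffSection.toMap V)
      + pointwiseLie (ContMDiffSection.toMap V) (ContMDiffSection.toMap W)))
    (fun V V' W => by
      rw [← map_add]
      congr 1
      simp only [map_add, SmoothVectorField.deriv_add_left, SmoothVectorField.deriv_add_right,
        LinearMap.add_apply]
      abel)
    (fun c V W => by
      rw [← map_smul]
      congr 1
      simp only [map_smul, SmoothVectorField.deriv_smul_left, SmoothVectorField.deriv_smul_right,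
        LinearMap.smul_apply]
      module)
    (fun V W W' => by
      rw [← map_add]
      congr 1
      simp only [map_add, SmoothVectorField.deriv_add_left, SmoothVectorField.deriv_add_right]
      abel)
    (fun c V W => by
      rw [← map_smul]
      congr 1
      simp only [map_smul, SmoothVectorField.deriv_smul_left, SmoothVectorField.deriv_smul_right]
      module)

theorem toMap_bracket [T2Space M] (V W : Cₛ^∞⟮I; LieModel 𝔤, Bundle.Trivial M (LieModel 𝔤)⟯) :
    ContMDiffSection.toMap (act.bracket V W)
      = SmoothVectorField.deriv (act.anchor.mapSec V) (ContMDiffSection.toMap W)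
      - SmoothVectorField.deriv (act.anchor.mapSec W) (ContMDiffSection.toMap V)
      + pointwiseLie (ContMDiffSection.toMap V) (ContMDiffSection.toMap W) := rfl

theorem bracket_mapSec [T2Space M] (Z : SmoothVectorField I M)
    (W : Cₛ^∞⟮I; LieModel 𝔤, Bundle.Trivial M (LieModel 𝔤)⟯) (x : M) :
    Z.bracket (act.anchor.mapSec W) x
      = act.toFun (LieModel.of.symm (Z.deriv (ContMDiffSection.toMap W) x)) x
        + Z.bracket (act.toFun (LieModel.of.symm (W x))) x := by
  let X (i) := act.toFun (LieModel.of.symm (finBasis ℝ (LieModel 𝔤) i))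
  let ev := ContMDiffSection.evalAt (I := I) (F := EM) (E := (TangentSpace I : M → Type _)) x
  let br : SmoothVectorField I M →ₗ[ℝ] SmoothVectorField I M :=
    ⟨⟨Z.bracket, Z.bracket_add_right⟩, fun c => Z.bracket_smul_right c⟩
  have h1 : act.anchor.mapSec W = ∑ i, coordFun W i • X i := by
    ext x
    exact (act.sum_apply W x).symm
  have h2 : Z.bracket (act.anchor.mapSec W) = ∑ i, Z.bracket (coordFun W i • X i) := by
    rw [h1]
    exact map_sum br _ _
  have h3 : Z.bracket (act.anchor.mapSec W) x
      = ∑ i, (coordFun W i x • Z.bracket (X i) x + Z.deriv (coordFun W i) x • X i x) := by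
    rw [h2]
    refine (map_sum ev _ _).trans (Finset.sum_congr rfl fun i _ => ?_)
    rw [SmoothVectorField.bracket_fsmul_right]
    rfl
  rw [h3, Finset.sum_add_distrib, add_comm]
  congr 1
  · refine Eq.trans (Finset.sum_congr rfl fun i _ => ?_) (map_eq_sum (ev ∘ₗ act.toFun) _).symm
    congr 1
    exact mvfderiv_clm_comp (LinearMap.toContinuousLinearMap ((finBasis ℝ (LieModel 𝔤)).coord i))
      (((ContMDiffSection.toMap W).contMDiff x).mdifferentiableAt (by simp)) (Z x)
  · exact (map_eq_sum (ev ∘ₗ br ∘ₗ act.toFun) (W x)).symm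

theorem anchor_bracket [T2Space M]
    (V W : Cₛ^∞⟮I; LieModel 𝔤, Bundle.Trivial M (LieModel 𝔤)⟯) :
    act.anchor.mapSec (act.bracket V W)
      = SmoothVectorField.bracket (act.anchor.mapSec V) (act.anchor.mapSec W) := by
  ext x
  rw [bracket_mapSec, SmoothVectorField.bracket_swap (act.anchor.mapSec V),
    ContMDiffSection.coe_neg, Pi.neg_apply, bracket_mapSec]
  have h1 : act.anchor.mapSec (act.bracket V W) x
      = act.toFun (LieModel.of.symm (ContMDiffSection.toMap (act.bracket V W) x)) x := rfl
  have h2 : (act.toFun (LieModel.of.symm (W x))).bracket (act.toFun (LieModel.of.symm (V x)))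
      = act.toFun ⁅LieModel.of.symm (W x), LieModel.of.symm (V x)⁆ := (act.map_lie _ _).symm
  have h3 : (act.toFun (LieModel.of.symm (W x))).deriv (ContMDiffSection.toMap V) x
      = SmoothVectorField.deriv (act.anchor.mapSec W) (ContMDiffSection.toMap V) x := rfl
  rw [h1, h2, h3, toMap_bracket]
  simp only [ContMDiffMap.coe_add, ContMDiffMap.coe_sub, Pi.add_apply, Pi.sub_apply, map_add,
    map_sub, pointwiseLie_apply, LinearEquiv.symm_apply_apply, ContMDiffSection.coe_add,
    ContMDiffSection.coe_sub, ← lie_skew (LieModel.of.symm (ContMDiffSection.toMap V x)), map_neg,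
    ContMDiffSection.coe_neg, Pi.neg_apply]
  rw [ContMDiffSection.toMap_apply, ContMDiffSection.toMap_apply]
  abel

end InfinitesimalAction

/-- The action Lie algebroid `𝔤 ⋉ M`, on the trivial bundle `M × 𝔤`. -/
noncomputable def actionAlgebroid [T2Space M] (act : InfinitesimalAction I M 𝔤) :
    LieAlgebroid I (LieModel 𝔤) (Bundle.Trivial M (LieModel 𝔤)) where
  anchor := act.anchor
  bracket := act.bracket
  bracket_self V := by
    apply ContMDiffSection.toMap.injective
    rw [act.toMap_bracket, pointwiseLie_self, map_zero]
    abel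
  jacobi V W U := by
    apply ContMDiffSection.toMap.injective
    simp only [map_add, map_zero, act.toMap_bracket, act.anchor_bracket,
      SmoothVectorField.deriv_bracket, SmoothVectorField.deriv_add_right,
      SmoothVectorField.deriv_sub_right, SmoothVectorField.deriv_pointwiseLie, map_sub]
    have h := pointwiseLie_jacobi (ContMDiffSection.toMap V) (ContMDiffSection.toMap W)
      (ContMDiffSection.toMap U)
    rw [← h]
    rw [pointwiseLie_swap (SmoothVectorField.deriv _ _) (ContMDiffSection.toMap V),
      pointwiseLie_swap (SmoothVectorField.deriv _ _) (ContMDiffSection.toMap W),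
      pointwiseLie_swap (SmoothVectorField.deriv _ _) (ContMDiffSection.toMap U)]
    abel
  anchor_bracket V W := act.anchor_bracket V W
  leibniz V f W := by
    apply ContMDiffSection.toMap.injective
    simp only [map_add, act.toMap_bracket, VBHom.mapSec_fsmul]
    ext x
    have h := SmoothVectorField.deriv_fsmul_right (act.anchor.mapSec V) f
      (ContMDiffSection.toMap W) x
    change mvfderiv I (fun y => f y • ContMDiffSection.toMap W y) x (act.anchor.mapSec V x)
      - mvfderiv I (ContMDiffSection.toMap V) x (f x • act.anchor.mapSec W x)
      + LieModel.lie 𝔤 (V x) (f x • W x)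
      = f x • (SmoothVectorField.deriv (act.anchor.mapSec V) (ContMDiffSection.toMap W) x
        - SmoothVectorField.deriv (act.anchor.mapSec W) (ContMDiffSection.toMap V) x
        + LieModel.lie 𝔤 (V x) (W x))
        + SmoothVectorField.deriv (act.anchor.mapSec V) f x • ContMDiffSection.toMap W x
    rw [h, map_smul, map_smul]
    change _ - f x • SmoothVectorField.deriv (act.anchor.mapSec W) (ContMDiffSection.toMap V) x
      + f x • LieModel.lie 𝔤 (V x) (W x) = _
    rw [ContMDiffSection.toMap_apply]
    module

end ActionAlgebroid

section Representations

variable {EM : Type*} [NormedAddCommGroup EM] [NormedSpace ℝ EM] [FiniteDimensional ℝ EM]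
  {H : Type*} [TopologicalSpace H] {I : ModelWithCorners ℝ EM H}
  {M : Type*} [TopologicalSpace M] [ChartedSpace H M] [IsManifold I ∞ M]
  {F : Type*} [NormedAddCommGroup F] [NormedSpace ℝ F]
  {E : M → Type*} [TopologicalSpace (TotalSpace F E)] [∀ x, AddCommGroup (E x)]
  [∀ x, Module ℝ (E x)] [∀ x, TopologicalSpace (E x)] [FiberBundle F E] [VectorBundle ℝ F E]
  {𝔤 : Type*} [LieRing 𝔤] [LieAlgebra ℝ 𝔤]

variable (𝔤 I F E) in
/-- A derivative representation of `𝔤` on `E`: a morphism of Lie algebras from `𝔤` to the Lie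
algebra of derivative endomorphisms of `ΓE`. -/
abbrev DerivativeRepresentation : Type _ := 𝔤 →ₗ⁅ℝ⁆ derivativeEndomorphisms I F E

/-- The derivative representation `ρ` is associated to the infinitesimal action `X ↦ X_M`:
`ρ(X)(fψ) = f ρ(X)ψ + X_M(f) ψ`. -/
def DerivativeRepresentation.IsAssociated (ρ : DerivativeRepresentation I F E 𝔤)
    (act : InfinitesimalAction I M 𝔤) : Prop :=
  ∀ (X : 𝔤) (f : C^∞⟮I, M; 𝓘(ℝ, ℝ), ℝ⟯) (ψ : Cₛ^∞⟮I; F, E⟯),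
    (ρ X : Module.End ℝ Cₛ^∞⟮I; F, E⟯) (f • ψ)
      = f • (ρ X : Module.End ℝ Cₛ^∞⟮I; F, E⟯) ψ + (act.toFun X).deriv f • ψ

variable {FA : Type*} [NormedAddCommGroup FA] [NormedSpace ℝ FA]
  {A : M → Type*} [TopologicalSpace (TotalSpace FA A)] [∀ x, AddCommGroup (A x)]
  [∀ x, Module ℝ (A x)] [∀ x, TopologicalSpace (A x)] [FiberBundle FA A] [VectorBundle ℝ FA A]

variable (F E) in
/-- A representation of a Lie algebroid on `E`: a Lie algebroid morphism to `𝔇(E)`. -/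
abbrev LieAlgebroid.Representation [T2Space M] [FiniteDimensional ℝ F]
    [ContMDiffVectorBundle ∞ F E I] (𝒜 : LieAlgebroid I FA A) : Type _ :=
  LieAlgebroid.Hom 𝒜 (derivationAlgebroid I F E)

end Representations

/-! A representation σ of 𝔤 ⋉ M is determined by its values on constant sections, since every point
(m, X) lies on the constant section X. The derivative terms of the action bracket vanish on constant
sections, so X ↦ (constant section X) is a morphism of Lie algebras. Composing it with σ and letting
sections of 𝔇(E) act on ΓE gives ρ. The anchor condition on σ says that the vector field of ρ(X) is
X_M, which is association.

Conversely, association says exactly that the pair of X_M(m) and ψ ↦ (ρ(X)ψ)(m) lies in 𝔇(E)_m, so σ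
is defined fibrewise and is linear in X. It is smooth because, in a basis e_i of 𝔤, a section V = ∑
V^i e_i acts by ψ ↦ ∑ V^i ρ(e_i)ψ, which is again a smooth section (`alongSection`).

Compatibility with brackets is the real content. Differentiating the coefficients
(`opAt_alongSection`) gives, at x, σ(V)(σ(W)ψ) = ρ(V(x))(ρ(W(x))ψ) + ρ(V_M(W)(x))ψ. Antisymmetrising
in V and W produces ρ applied to V_M(W) - W_M(V) + [V, W]^•, because ρ preserves brackets. This
treats arbitrary sections at once, without a reduction to constant ones. The two constructions are
then inverse to each other, almost by definition. -/

section ActionRepresentations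

variable {EM : Type*} [NormedAddCommGroup EM] [NormedSpace ℝ EM] [FiniteDimensional ℝ EM]
  {H : Type*} [TopologicalSpace H] {I : ModelWithCorners ℝ EM H}
  {M : Type*} [TopologicalSpace M] [ChartedSpace H M] [IsManifold I ∞ M]
  {F : Type*} [NormedAddCommGroup F] [NormedSpace ℝ F]
  {E : M → Type*} [TopologicalSpace (TotalSpace F E)] [∀ x, AddCommGroup (E x)]
  [∀ x, Module ℝ (E x)] [∀ x, TopologicalSpace (E x)] [FiberBundle F E] [VectorBundle ℝ F E]
  {𝔤 : Type*} [LieRing 𝔤] [LieAlgebra ℝ 𝔤]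
  {act : InfinitesimalAction I M 𝔤}

/-! ### Preliminaries: equality of algebroid morphisms, and vector fields as derivations. -/

namespace LieAlgebroid.Hom

variable {FA : Type*} [NormedAddCommGroup FA] [NormedSpace ℝ FA]
  {A : M → Type*} [TopologicalSpace (TotalSpace FA A)] [∀ x, AddCommGroup (A x)]
  [∀ x, Module ℝ (A x)] [∀ x, TopologicalSpace (A x)] [FiberBundle FA A] [VectorBundle ℝ FA A]
  {FB : Type*} [NormedAddCommGroup FB] [NormedSpace ℝ FB]
  {B : M → Type*} [TopologicalSpace (TotalSpace FB B)] [∀ x, AddCommGroup (B x)]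
  [∀ x, Module ℝ (B x)] [∀ x, TopologicalSpace (B x)] [FiberBundle FB B] [VectorBundle ℝ FB B]

/-- Smoothness and the two compatibility conditions are propositions, so the fibre maps are the only
data. This reduces the round trip starting from σ to a pointwise check. -/
theorem ext_apply {𝒜 : LieAlgebroid I FA A} {ℬ : LieAlgebroid I FB B} {σ τ : Hom 𝒜 ℬ}
    (h : ∀ x a, σ.toFun x a = τ.toFun x a) : σ = τ := by
  obtain ⟨⟨s, _⟩, _, _⟩ := σ
  obtain ⟨⟨t, _⟩, _, _⟩ := τ
  obtain rfl : s = t := funext fun x => LinearMap.ext (h x)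
  rfl

end LieAlgebroid.Hom

/-- The derivative of functions along a smooth vector field, as a linear map. -/
noncomputable def SmoothVectorField.derivₗ (X : SmoothVectorField I M) :
    C^∞⟮I, M; 𝓘(ℝ, ℝ), ℝ⟯ →ₗ[ℝ] C^∞⟮I, M; 𝓘(ℝ, ℝ), ℝ⟯ where
  toFun := X.deriv
  map_add' := X.deriv_add_right
  map_smul' := X.deriv_smul_right

/-! ### From a derivative representation to a representation of the action algebroid. -/

namespace DerivativeRepresentation

/-- The operator `ψ ↦ (ρ(X)ψ)(x)`, as a linear function of `X`. -/
noncomputable def opAt (ρ : DerivativeRepresentation I F E 𝔤) (x : M) :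
    𝔤 →ₗ[ℝ] Cₛ^∞⟮I; F, E⟯ →ₗ[ℝ] E x :=
  (ContMDiffSection.evalAt x).compRight ℝ ∘ₗ (derivativeEndomorphisms I F E).toSubmodule.subtype
    ∘ₗ ρ.toLinearMap

theorem opAt_apply (ρ : DerivativeRepresentation I F E 𝔤) (x : M) (X : 𝔤) (ψ : Cₛ^∞⟮I; F, E⟯) :
    ρ.opAt x X ψ = (ρ X : Module.End ℝ Cₛ^∞⟮I; F, E⟯) ψ x := rfl

/-- Association evaluated at a point. It is the membership condition for the fibre of 𝔇(E) at x with
tangent vector X_M(x), and it is also the Leibniz rule behind the bracket computation. -/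
theorem opAt_fsmul {ρ : DerivativeRepresentation I F E 𝔤} (hρ : ρ.IsAssociated act) (x : M)
    (X : 𝔤) (f : C^∞⟮I, M; 𝓘(ℝ, ℝ), ℝ⟯) (ψ : Cₛ^∞⟮I; F, E⟯) :
    ρ.opAt x X (f • ψ) = f x • ρ.opAt x X ψ + (act.toFun X).deriv f x • ψ x :=
  congrArg (fun φ => φ x) (hρ X f ψ)

/-- The bracket of derivative endomorphisms is the commutator. Only the outer operator is evaluated
at x: it differentiates, so it needs the inner result as a section and not merely its value at x. -/
theorem opAt_lie (ρ : DerivativeRepresentation I F E 𝔤) (x : M) (X Y : 𝔤) (ψ : Cₛ^∞⟮I; F, E⟯) :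
    ρ.opAt x ⁅X, Y⁆ ψ = ρ.opAt x X ((ρ Y : Module.End ℝ Cₛ^∞⟮I; F, E⟯) ψ)
      - ρ.opAt x Y ((ρ X : Module.End ℝ Cₛ^∞⟮I; F, E⟯) ψ) := by
  rw [opAt_apply, LieHom.map_lie]
  rfl

variable [FiniteDimensional ℝ 𝔤]

/-- The section `x ↦ (ρ(V(x))ψ)(x)` of `E`. -/
noncomputable def alongSection (ρ : DerivativeRepresentation I F E 𝔤)
    (V : Cₛ^∞⟮I; LieModel 𝔤, Bundle.Trivial M (LieModel 𝔤)⟯) (ψ : Cₛ^∞⟮I; F, E⟯) :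
    Cₛ^∞⟮I; F, E⟯ :=
  -- Expanding V in a basis of 𝔤 makes smoothness automatic: this is a finite combination of the
  -- smooth sections ρ(e_i)ψ with smooth coefficients.
  ∑ i, InfinitesimalAction.coordFun V i •
    (ρ (LieModel.of.symm (finBasis ℝ (LieModel 𝔤) i)) : Module.End ℝ Cₛ^∞⟮I; F, E⟯) ψ

/-- For fixed x and ψ the value (ρ(X)ψ)(x) is linear in X, so the basis expansion collapses. In
particular the sum does not depend on the basis. -/
theorem alongSection_apply (ρ : DerivativeRepresentation I F E 𝔤)
    (V : Cₛ^∞⟮I; LieModel 𝔤, Bundle.Trivial M (LieModel 𝔤)⟯) (ψ : Cₛ^∞⟮I; F, E⟯) (x : M) :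
    ρ.alongSection V ψ x = ρ.opAt x (LieModel.of.symm (V x)) ψ :=
  (map_sum (ContMDiffSection.evalAt (I := I) (F := F) (E := E) x) _ Finset.univ).trans
    (InfinitesimalAction.map_eq_sum ((ρ.opAt x).flip ψ) (V x)).symm

/-- The key formula: applying ρ(X) to ∑ W^i ρ(e_i)ψ gives, by the Leibniz rule, the terms W^i(x)
ρ(X)ρ(e_i)ψ and the terms X_M(W^i)(x) ρ(e_i)ψ. The first family reassembles to ρ(W(x)) and the
second to ρ of the derivative of W along X_M, which is the derivative term of the action bracket. -/
theorem opAt_alongSection {ρ : DerivativeRepresentation I F E 𝔤} (hρ : ρ.IsAssociated act)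
    (X : 𝔤) (W : Cₛ^∞⟮I; LieModel 𝔤, Bundle.Trivial M (LieModel 𝔤)⟯) (ψ : Cₛ^∞⟮I; F, E⟯) (x : M) :
    ρ.opAt x X (ρ.alongSection W ψ)
      = ρ.opAt x X ((ρ (LieModel.of.symm (W x)) : Module.End ℝ Cₛ^∞⟮I; F, E⟯) ψ)
        + ρ.opAt x (LieModel.of.symm
          ((act.toFun X).deriv (ContMDiffSection.toMap W) x)) ψ := by
  rw [alongSection, map_sum]
  simp only [opAt_fsmul hρ]
  rw [Finset.sum_add_distrib]
  congr 1
  -- The undifferentiated terms: Y ↦ (ρ(X)(ρ(Y)ψ))(x) is linear in Y, and is expanded here at the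
  -- fixed vector Y = W(x).
  · exact (InfinitesimalAction.map_eq_sum (ρ.opAt x X ∘ₗ
      ((derivativeEndomorphisms I F E).toSubmodule.subtype ∘ₗ ρ.toLinearMap).flip ψ) (W x)).symm
  -- The differentiated terms: a coordinate function on 𝔤 is a fixed linear form, so the derivative
  -- of the coordinate W^i is the coordinate of the derivative of W.
  · refine Eq.trans (Finset.sum_congr rfl fun i _ => ?_)
      (InfinitesimalAction.map_eq_sum ((ρ.opAt x).flip ψ) _).symm
    refine congrArg (· • ρ.opAt x (LieModel.of.symm (finBasis ℝ (LieModel 𝔤) i)) ψ) ?_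
    exact mvfderiv_clm_comp (LinearMap.toContinuousLinearMap ((finBasis ℝ (LieModel 𝔤)).coord i))
      (((ContMDiffSection.toMap W).contMDiff x).mdifferentiableAt (by simp)) (act.toFun X x)

variable [T2Space M] [FiniteDimensional ℝ F] [ContMDiffVectorBundle ∞ F E I]

/-- The linear map `X ↦ (X_M(x), ψ ↦ (ρ(X)ψ)(x))` from `𝔤` to the fibre of `𝔇(E)` at `x`. -/
noncomputable def toDerFiber {ρ : DerivativeRepresentation I F E 𝔤} (hρ : ρ.IsAssociated act)
    (x : M) : Bundle.Trivial M (LieModel 𝔤) x →ₗ[ℝ] DerBundle I F E x where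
  toFun X := DerBundle.mk (act.toFun (LieModel.of.symm X) x)
    (ρ.opAt x (LieModel.of.symm X)) (opAt_fsmul hρ x _)
  -- The tangent component is the anchor of 𝔤 ⋉ M at x, already known to be linear.
  map_add' X Y := DerBundle.ext (map_add (act.anchor.toFun x) X Y)
    (map_add (ρ.opAt x ∘ₗ LieModel.of.symm.toLinearMap) X Y)
  map_smul' c X := DerBundle.ext (map_smul (act.anchor.toFun x) c X)
    (map_smul (ρ.opAt x ∘ₗ LieModel.of.symm.toLinearMap) c X)

/-- The bundle map `(x, X) ↦ (X_M(x), ψ ↦ (ρ(X)ψ)(x))`. -/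
noncomputable def toVBHom {ρ : DerivativeRepresentation I F E 𝔤} (hρ : ρ.IsAssociated act) :
    VBHom I (LieModel 𝔤) (Bundle.Trivial M (LieModel 𝔤)) (EM × (F →L[ℝ] F))
      (DerBundle I F E) where
  toFun := toDerFiber hρ
  contMDiff_total := by
    -- It suffices that smooth sections V go to smooth sections of 𝔇(E), and smoothness there is
    -- tested on the vector field and on each ψ. The vector field is V_M; the image of ψ is
    -- `alongSection`.
    refine contMDiff_total_of_sections (toDerFiber hρ) fun V x => DerBundle.contMDiffAt_iff.2
      ⟨act.contMDiff_anchor V x, fun ψ => ?_⟩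
    refine ((ρ.alongSection V ψ).contMDiff x).congr_of_eventuallyEq
      (Filter.Eventually.of_forall fun y => ?_)
    exact congrArg (fun v => (⟨y, v⟩ : TotalSpace F E)) (ρ.alongSection_apply V ψ y).symm

/-- Replaces the operator of σ(V) by the explicit basis sum, to which the Leibniz formula
`opAt_alongSection` applies when operators are composed. -/
theorem act_mapSec_toVBHom {ρ : DerivativeRepresentation I F E 𝔤} (hρ : ρ.IsAssociated act)
    (V : Cₛ^∞⟮I; LieModel 𝔤, Bundle.Trivial M (LieModel 𝔤)⟯) (ψ : Cₛ^∞⟮I; F, E⟯) :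
    DerBundle.act ((toVBHom hρ).mapSec V) ψ = ρ.alongSection V ψ := by
  ext x
  exact (ρ.alongSection_apply V ψ x).symm

/-- The representation of the action Lie algebroid defined by a derivative representation. -/
noncomputable def toRepresentation {ρ : DerivativeRepresentation I F E 𝔤}
    (hρ : ρ.IsAssociated act) : LieAlgebroid.Representation F E (actionAlgebroid act) where
  toVBHom := toVBHom hρ
  anchor_comp _ _ := rfl
  map_bracket V W := by
    -- A section of 𝔇(E) is its vector field together with its operator. For the vector fields the
    -- claim is that the anchor of 𝔤 ⋉ M preserves brackets; the operators remain.
    refine DerBundle.section_ext (act.anchor_bracket V W) (LinearMap.ext fun ψ => ?_)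
    change _ = DerBundle.act ((toVBHom hρ).mapSec V) (DerBundle.act ((toVBHom hρ).mapSec W) ψ)
      - DerBundle.act ((toVBHom hρ).mapSec W) (DerBundle.act ((toVBHom hρ).mapSec V) ψ)
    simp only [act_mapSec_toVBHom]
    ext x
    rw [ContMDiffSection.coe_sub, Pi.sub_apply]
    -- Each composite on the right splits into a second-order term, with V(x) and W(x) frozen, and a
    -- term carrying the derivative of the inner section.
    simp only [alongSection_apply, opAt_alongSection hρ]
    change ρ.opAt x (LieModel.of.symm
      (SmoothVectorField.deriv (act.anchor.mapSec V) (ContMDiffSection.toMap W) x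
        - SmoothVectorField.deriv (act.anchor.mapSec W) (ContMDiffSection.toMap V) x
        + LieModel.of ⁅LieModel.of.symm (V x), LieModel.of.symm (W x)⁆)) ψ = _
    rw [map_add, map_sub, LinearEquiv.symm_apply_apply, map_add, map_sub, LinearMap.add_apply,
      LinearMap.sub_apply, opAt_lie]
    -- A derivative at x depends on the vector field only through its value there, so V_M may be
    -- replaced by the fundamental field of the constant V(x), and likewise for W. The derivative
    -- terms on both sides then agree literally.
    change ρ.opAt x (LieModel.of.symm ((act.toFun (LieModel.of.symm (V x))).deriv
        (ContMDiffSection.toMap W) x)) ψ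
      - ρ.opAt x (LieModel.of.symm ((act.toFun (LieModel.of.symm (W x))).deriv
        (ContMDiffSection.toMap V) x)) ψ + _ = _
    abel

end DerivativeRepresentation

/-! ### Constant sections, and the way back to derivative representations. -/

variable [FiniteDimensional ℝ 𝔤]

variable (I M) in
/-- The constant sections of `M × 𝔤`. -/
noncomputable def constSection :
    𝔤 →ₗ[ℝ] Cₛ^∞⟮I; LieModel 𝔤, Bundle.Trivial M (LieModel 𝔤)⟯ where
  toFun X := ContMDiffSection.toMap.symm ⟨fun _ => LieModel.of X, contMDiff_const⟩
  map_add' _ _ := rfl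
  map_smul' _ _ := rfl

theorem SmoothVectorField.deriv_constSection (Z : SmoothVectorField I M) (X : 𝔤) :
    Z.deriv (ContMDiffSection.toMap (constSection I M X)) = 0 := by
  ext x
  change mvfderiv I (fun _ : M => LieModel.of X) x (Z x) = 0
  rw [mvfderiv_const]
  rfl

variable [T2Space M] [FiniteDimensional ℝ F] [ContMDiffVectorBundle ∞ F E I]

/-- Both derivative terms vanish and only the pointwise bracket survives. This is why restricting σ
to constant sections yields a Lie algebra morphism. -/
theorem InfinitesimalAction.bracket_constSection (act : InfinitesimalAction I M 𝔤) (X Y : 𝔤) :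
    act.bracket (constSection I M X) (constSection I M Y) = constSection I M ⁅X, Y⁆ := by
  apply ContMDiffSection.toMap.injective
  rw [act.toMap_bracket, SmoothVectorField.deriv_constSection,
    SmoothVectorField.deriv_constSection, sub_zero, zero_add]
  rfl

namespace LieAlgebroid.Representation

/-- The anchor condition identifies the vector field of σ(X) with X_M. The resulting Leibniz rule
serves twice: it makes the operator a derivative endomorphism, and it is the association with the
given action. -/
theorem act_constSection_fsmul (σ : LieAlgebroid.Representation F E (actionAlgebroid act)) (X : 𝔤)
    (f : C^∞⟮I, M; 𝓘(ℝ, ℝ), ℝ⟯) (ψ : Cₛ^∞⟮I; F, E⟯) :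
    DerBundle.act (σ.mapSec (constSection I M X)) (f • ψ)
      = f • DerBundle.act (σ.mapSec (constSection I M X)) ψ + (act.toFun X).deriv f • ψ := by
  have h : (DerBundle.anchor I F E).mapSec (σ.mapSec (constSection I M X)) = act.toFun X := by
    ext x
    exact σ.anchor_comp x (LieModel.of X)
  rw [DerBundle.act_fsmul, h]

/-- The derivative representation defined by a representation of the action Lie algebroid. -/
noncomputable def toDerivativeRepresentation
    (σ : LieAlgebroid.Representation F E (actionAlgebroid act)) :
    DerivativeRepresentation I F E 𝔤 where
  toFun X := ⟨DerBundle.act (σ.mapSec (constSection I M X)),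
    -- The witness for D_M is differentiation along X_M. If E has rank zero, D_M is not determined
    -- by the operator, so the choice has to come from the action.
    (act.toFun X).derivₗ, act_constSection_fsmul σ X⟩
  map_add' X Y := Subtype.ext <|
    (congrArg DerBundle.act (map_add (σ.mapSec ∘ₗ constSection I M) X Y)).trans
      (DerBundle.act_add _ _)
  map_smul' c X := Subtype.ext <|
    (congrArg DerBundle.act (map_smul (σ.mapSec ∘ₗ constSection I M) c X)).trans
      (DerBundle.act_smul _ _)
  map_lie' {X Y} := Subtype.ext <| by
    -- Passing from sections of 𝔇(E) to operators turns the bracket into the commutator by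
    -- definition, so the bracket condition on constant sections is all that is needed.
    have h := σ.map_bracket (constSection I M X) (constSection I M Y)
    have h' : (actionAlgebroid act).bracket (constSection I M X) (constSection I M Y)
        = constSection I M ⁅X, Y⁆ := act.bracket_constSection X Y
    rw [h'] at h
    exact congrArg DerBundle.act h

theorem toDerivativeRepresentation_isAssociated
    (σ : LieAlgebroid.Representation F E (actionAlgebroid act)) :
    (toDerivativeRepresentation σ).IsAssociated act :=
  act_constSection_fsmul σ

end LieAlgebroid.Representation

/-- Derivative representations of `𝔤` associated to an infinitesimal action correspond to
representations of the action Lie algebroid. -/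
noncomputable def derivativeRepresentationEquiv (act : InfinitesimalAction I M 𝔤) :
    {ρ : DerivativeRepresentation I F E 𝔤 // ρ.IsAssociated act} ≃
      LieAlgebroid.Representation F E (actionAlgebroid act) where
  toFun ρ := DerivativeRepresentation.toRepresentation ρ.2
  invFun σ := ⟨LieAlgebroid.Representation.toDerivativeRepresentation σ,
    LieAlgebroid.Representation.toDerivativeRepresentation_isAssociated σ⟩
  -- The operator recovered from the constant section X sends ψ to x ↦ (ρ(X)ψ)(x), which is ρ(X)ψ
  -- itself.
  left_inv _ := rfl
  right_inv σ := LieAlgebroid.Hom.ext_apply fun x X =>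
    -- The operator parts agree because the constant section X takes the value X at x. The tangent
    -- part was rebuilt from the action, so it matches that of σ only through the anchor condition.
    DerBundle.ext (σ.anchor_comp x X).symm rfl

end ActionRepresentations

theorem theorem2p4
    {EM : Type*} [NormedAddCommGroup EM] [NormedSpace ℝ EM] [FiniteDimensional ℝ EM]
    {H : Type*} [TopologicalSpace H] {I : ModelWithCorners ℝ EM H}
    {M : Type*} [TopologicalSpace M] [ChartedSpace H M] [IsManifold I ∞ M]
    [BoundarylessManifold I M] [T2Space M] [SecondCountableTopology M]
    {F : Type*} [NormedAddCommGroup F] [NormedSpace ℝ F] [FiniteDimensional ℝ F]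
    {E : M → Type*} [TopologicalSpace (TotalSpace F E)] [∀ x, AddCommGroup (E x)]
    [∀ x, Module ℝ (E x)] [∀ x, TopologicalSpace (E x)] [FiberBundle F E] [VectorBundle ℝ F E]
    [ContMDiffVectorBundle ∞ F E I]
    {𝔤 : Type*} [LieRing 𝔤] [LieAlgebra ℝ 𝔤] [FiniteDimensional ℝ 𝔤]
    (act : InfinitesimalAction I M 𝔤) :
    ∃ e : {ρ : DerivativeRepresentation I F E 𝔤 // ρ.IsAssociated act} ≃
        LieAlgebroid.Representation F E (actionAlgebroid act),
      ∀ (ρ : {ρ : DerivativeRepresentation I F E 𝔤 // ρ.IsAssociated act}) (m : M) (X : 𝔤),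
        ((e ρ).toFun m (LieModel.of X)).vec = act.toFun X m ∧
        ∀ ψ : Cₛ^∞⟮I; F, E⟯, ((e ρ).toFun m (LieModel.of X)).op ψ
          = (ρ.1 X : Module.End ℝ Cₛ^∞⟮I; F, E⟯) ψ m :=
  ⟨derivativeRepresentationEquiv act, fun _ _ _ => ⟨rfl, fun _ => rfl⟩⟩
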